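/- Let $\mathbb D=\{z\in\mathbb C:|z|<1\}$. Let $\mathcal B_\infty(\mathbb D)$ be the Bloch space, i.e. the holomorphic functions $f$ on $\mathbb D$ with $\sup_{z\in\mathbb D}(1-|z|^2)|f'(z)|<\infty$, with norm $\|f\|=|f(0)|+\sup_{z\in\mathbb D}(1-|z|^2)|f'(z)|$, and let the little Bloch space $\mathcal B_{\infty,0}(\mathbb D)$ be the closure of the polynomials in $\mathcal B_\infty(\mathbb D)$. Let $M_z$ be the operator $(M_zf)(z)=zf(z)$ on $\mathcal B_{\infty,0}(\mathbb D)$, and write $\mathbb Z_+=\{0,1,2,\dots\}$. **Proposition 4.1.** Let $\gamma\in\mathbb R$. The operators $$S_{u_t}f(z)=e^{-2i\gamma t}f(e^{-2it}z)\qquad(t\in\mathbb R)$$ form a strongly continuous group of isometries of $\mathcal B_{\infty,0}(\mathbb D)$. Let $\Gamma$ be its infinitesimal generator, $\Gamma f=\lim_{t\to0^+}(S_{u_t}f-f)/t$ (limit in norm), with domain the set of all $f$ for which the limit exists. Denote by $\rho(\Gamma)$, $\sigma(\Gamma)=\mathbb C\setminus\rho(\Gamma)$, $\sigma_p(\Gamma)$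 and $R(\mu,\Gamma)=(\mu-\Gamma)^{-1}$ its resolvent set, spectrum, point spectrum and resolvent. 1. $\mathrm{dom}(\Gamma)=\{f\in\mathcal B_{\infty,0}(\mathbb D): f'\in\mathcal B_{\infty,0}(\mathbb D)\}$, and $\Gamma f(z)=i\left(-2\gamma f(z)-2zf'(z)\right)$ for every $f\in\mathrm{dom}(\Gamma)$ and $z\in\mathbb D$. 2. $\sigma(\Gamma)=\sigma_p(\Gamma)=\{-2(\gamma+n)i: n\in\mathbb Z_+\}$, and for each $n\ge0$, $\ker\left(-2(\gamma+n)i-\Gamma\right)=\mathrm{span}(z^n)$. 3. If $\mu\in\rho(\Gamma)$, then $\mathrm{ran}(M_z^m)$ is $R(\mu,\Gamma)$-invariant for every $m\in\mathbb Z_+$ with $m>\operatorname{Im}\left(-(\mu+2\gamma i)/2\right)$. Moreover, if $h\in\mathrm{ran}(M_z^m)$ for such an $m$, then for $z\in\mathbb D\setminus\{0\}$ $$R(\mu,\Gamma)h(z)=-\frac i2\,z^{\left(\frac{\mu+2i\gamma}2\right)i}\int_0^z\omega^{-\left(\frac{\mu+2i\gamma}2\right)i-1}h(\omega)\,d\omega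 ,$$ where the integral is taken along the segment from $0$ to $z$ and converges absolutely, and the powers are principal powers (with $\arg\in(-\pi,\pi]$). -/

import Mathlib

open Complex Filter Topology

noncomputable section

namespace LittleBloch

/-- The open unit disc. -/
abbrev disc : Set ℂ := Metric.ball (0 : ℂ) 1

/-- The Bloch space as a space of functions. A holomorphic function on the disc is represented by
its extension by zero to the plane (so that equality of functions is equality on the disc). -/
def blochSubmodule : Submodule ℂ (ℂ → ℂ) where
  carrier := {f | DifferentiableOn ℂ f disc ∧ (∀ z, z ∉ disc → f z = 0) ∧
    BddAbove (Set.range fun z : disc => (1 - ‖(z : ℂ)‖ ^ 2) * ‖deriv f z‖)}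
  zero_mem' := by
    refine ⟨differentiableOn_const 0, fun _ _ => rfl, 0, ?_⟩
    rintro _ ⟨z, rfl⟩
    have : deriv (0 : ℂ → ℂ) z = 0 := by
      simp
    simp [this]
  add_mem' := by
    rintro f g ⟨hf, hf0, A, hA⟩ ⟨hg, hg0, B, hB⟩
    refine ⟨hf.add hg, fun z hz => by simp [hf0 z hz, hg0 z hz], A + B, ?_⟩
    rintro _ ⟨z, rfl⟩
    have hz := Metric.isOpen_ball.mem_nhds z.2
    have h1 := hA ⟨z, rfl⟩
    have h2 := hB ⟨z, rfl⟩
    have h3 : (0 : ℝ) ≤ 1 - ‖(z : ℂ)‖ ^ 2 := by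
      have := mem_ball_zero_iff.1 z.2
      nlinarith [norm_nonneg (z : ℂ)]
    simp only at h1 h2 ⊢
    rw [deriv_add (hf.differentiableAt hz) (hg.differentiableAt hz)]
    nlinarith [mul_le_mul_of_nonneg_left (norm_add_le (deriv f z) (deriv g z)) h3]
  smul_mem' := by
    rintro c f ⟨hf, hf0, A, hA⟩
    refine ⟨hf.const_smul c, fun z hz => by simp [hf0 z hz], ‖c‖ * A, ?_⟩
    rintro _ ⟨z, rfl⟩
    have hz := Metric.isOpen_ball.mem_nhds z.2
    have h1 := hA ⟨z, rfl⟩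
    simp only at h1 ⊢
    rw [deriv_const_smul c (hf.differentiableAt hz), norm_smul]
    nlinarith [mul_le_mul_of_nonneg_left h1 (norm_nonneg c)]

/-- The Bloch space of the disc (a separate type, so that it carries the topology of its norm and
not that of pointwise convergence). -/
def Bloch : Type := blochSubmodule

namespace Bloch

instance : AddCommGroup Bloch := inferInstanceAs (AddCommGroup blochSubmodule)

instance : Module ℂ Bloch := inferInstanceAs (Module ℂ blochSubmodule)

instance : FunLike Bloch ℂ ℂ where
  coe f := f.1
  coe_injective _ _ h := Subtype.ext h

theorem differentiableOn (f : Bloch) : DifferentiableOn ℂ f disc := f.2.1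

theorem differentiableAt (f : Bloch) {z : ℂ} (hz : z ∈ disc) : DifferentiableAt ℂ f z :=
  f.differentiableOn.differentiableAt (Metric.isOpen_ball.mem_nhds hz)

theorem apply_eq_zero (f : Bloch) {z : ℂ} (hz : z ∉ disc) : f z = 0 := f.2.2.1 z hz

@[simp] theorem coe_add (f g : Bloch) : ⇑(f + g) = f + g := rfl

@[simp] theorem coe_smul (c : ℂ) (f : Bloch) : ⇑(c • f) = c • ⇑f := rfl

@[simp] theorem coe_zero : ⇑(0 : Bloch) = 0 := rfl

@[simp] theorem coe_neg (f : Bloch) : ⇑(-f) = -⇑f := rfl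

/-- The Bloch seminorm `sup_{|z| < 1} (1 - |z|²) |f'(z)|` of a function. -/
def seminorm (f : ℂ → ℂ) : ℝ := ⨆ z : disc, (1 - ‖(z : ℂ)‖ ^ 2) * ‖deriv f z‖

theorem one_sub_nonneg (z : disc) : (0 : ℝ) ≤ 1 - ‖(z : ℂ)‖ ^ 2 := by
  have := mem_ball_zero_iff.1 z.2
  nlinarith [norm_nonneg (z : ℂ)]

theorem le_seminorm (f : Bloch) (z : disc) :
    (1 - ‖(z : ℂ)‖ ^ 2) * ‖deriv f z‖ ≤ seminorm f := le_ciSup f.2.2.2 z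

theorem seminorm_nonneg (f : ℂ → ℂ) : 0 ≤ seminorm f :=
  Real.iSup_nonneg fun z => mul_nonneg (one_sub_nonneg z) (norm_nonneg _)

theorem seminorm_add_le (f g : Bloch) : seminorm ⇑(f + g) ≤ seminorm f + seminorm g := by
  have : Nonempty disc := ⟨⟨0, by simp⟩⟩
  refine ciSup_le fun z => ?_
  rw [coe_add, deriv_add (f.differentiableAt z.2) (g.differentiableAt z.2)]
  nlinarith [mul_le_mul_of_nonneg_left (norm_add_le (deriv f z) (deriv g z)) (one_sub_nonneg z),
    le_seminorm f z, le_seminorm g z]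

/-- The norm `‖f‖ = |f(0)| + sup_{|z| < 1} (1 - |z|²) |f'(z)|` of the Bloch space. -/
def blochNorm : AddGroupNorm Bloch where
  toFun f := ‖f 0‖ + seminorm f
  map_zero' := by
    have : ∀ z : ℂ, deriv (0 : ℂ → ℂ) z = 0 := fun z => by simp
    simp [seminorm, this]
  add_le' f g := by
    have h := seminorm_add_le f g
    have h' : ‖(f + g) 0‖ ≤ ‖f 0‖ + ‖g 0‖ := norm_add_le _ _
    linarith
  neg' f := by
    simp [seminorm]
  eq_zero_of_map_eq_zero' f hf := by
    have h0 : 0 ≤ seminorm f := seminorm_nonneg f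
    have h1 : f 0 = 0 := norm_eq_zero.1 (by linarith [norm_nonneg (f 0)])
    have h2 : seminorm f = 0 := by linarith [norm_nonneg (f 0)]
    have h3 : Set.EqOn (deriv f) 0 disc := by
      intro z hz
      have h4 := le_seminorm f ⟨z, hz⟩
      have h5 : (0 : ℝ) < 1 - ‖z‖ ^ 2 := by
        have := mem_ball_zero_iff.1 hz
        nlinarith [norm_nonneg z]
      rw [h2] at h4
      have h6 : ‖deriv f z‖ ≤ 0 := nonpos_of_mul_nonpos_right h4 h5
      simpa using h6
    refine DFunLike.ext _ _ fun z => ?_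
    by_cases hz : z ∈ disc
    · have := Metric.isOpen_ball.is_const_of_deriv_eq_zero
        (convex_ball (0 : ℂ) 1).isPreconnected f.differentiableOn h3 hz
        (show (0 : ℂ) ∈ disc by simp)
      rw [this, h1]; rfl
    · rw [f.apply_eq_zero hz]; rfl

instance : NormedAddCommGroup Bloch := blochNorm.toNormedAddCommGroup

theorem norm_def (f : Bloch) : ‖f‖ = ‖f 0‖ + seminorm f := rfl

instance : NormedSpace ℂ Bloch where
  norm_smul_le c f := by
    have h : seminorm ⇑(c • f) = ‖c‖ * seminorm f := by
      rw [seminorm, seminorm, Real.mul_iSup_of_nonneg (norm_nonneg c)]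
      congr 1
      funext z
      rw [coe_smul, deriv_const_smul c (f.differentiableAt z.2), norm_smul]
      ring
    rw [norm_def, norm_def, h]
    simp [mul_add]

/-- The polynomial `p`, as an element of the Bloch space. -/
def ofPoly : Polynomial ℂ →ₗ[ℂ] Bloch where
  toFun p := ⟨Set.indicator disc fun z => p.eval z, by
    have hd : ∀ z ∈ disc, (Set.indicator disc fun z => p.eval z) =ᶠ[𝓝 z] fun z => p.eval z :=
      fun z hz => Filter.eventuallyEq_of_mem (Metric.isOpen_ball.mem_nhds hz)
        fun w hw => Set.indicator_of_mem hw _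
    refine ⟨p.differentiable.differentiableOn.congr fun z hz => Set.indicator_of_mem hz _,
      fun z hz => Set.indicator_of_notMem hz _, ?_⟩
    obtain ⟨C, hC⟩ := (isCompact_closedBall (0 : ℂ) 1).exists_bound_of_continuousOn
      (Polynomial.derivative p).continuous.continuousOn
    refine ⟨C, ?_⟩
    rintro _ ⟨z, rfl⟩
    have h1 := hC z (Metric.ball_subset_closedBall z.2)
    have h2 := one_sub_nonneg z
    simp only
    rw [(hd z z.2).deriv_eq, Polynomial.deriv]
    nlinarith [norm_nonneg (Polynomial.eval (z : ℂ) (Polynomial.derivative p)),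
      sq_nonneg ‖(z : ℂ)‖]⟩
  map_add' p q := by
    refine Subtype.ext (funext fun z => ?_)
    change Set.indicator disc (fun z => (p + q).eval z) z =
      Set.indicator disc (fun z => p.eval z) z + Set.indicator disc (fun z => q.eval z) z
    by_cases hz : z ∈ disc <;> simp [hz]
  map_smul' c p := by
    refine Subtype.ext (funext fun z => ?_)
    change Set.indicator disc (fun z => (c • p).eval z) z =
      c • Set.indicator disc (fun z => p.eval z) z
    by_cases hz : z ∈ disc <;> simp [hz]

theorem ofPoly_apply (p : Polynomial ℂ) {z : ℂ} (hz : z ∈ disc) : ofPoly p z = p.eval z :=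
  Set.indicator_of_mem hz fun z => p.eval z

end Bloch

/-- The little Bloch space: the closure of the polynomials in the Bloch space. -/
def littleBloch : Submodule ℂ Bloch := (LinearMap.range Bloch.ofPoly).topologicalClosure

/-- The function `z ↦ z ^ n` in the little Bloch space. -/
def monomial (n : ℕ) : littleBloch :=
  ⟨Bloch.ofPoly (Polynomial.X ^ n), Submodule.le_topologicalClosure _ ⟨_, rfl⟩⟩

/-- The isometry `f ↦ a f(b z)` of the Bloch space, for unimodular `a` and `b`. -/
def rotIsom (a b : ℂ) (ha : ‖a‖ = 1) (hb : ‖b‖ = 1) : Bloch →ₗᵢ[ℂ] Bloch where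
  toFun f := ⟨fun z => a * f (b * z), by
    have hm : ∀ z : ℂ, b * z ∈ disc ↔ z ∈ disc := fun z => by simp [hb]
    refine ⟨fun z hz => ?_, fun z hz => ?_, ?_⟩
    · have h := f.differentiableAt ((hm z).2 hz)
      exact ((h.comp z (differentiableAt_id.const_mul b)).const_mul a).differentiableWithinAt
    · simp only
      rw [f.apply_eq_zero fun h => hz ((hm z).1 h), mul_zero]
    · obtain ⟨A, hA⟩ := f.2.2.2
      refine ⟨A, ?_⟩
      rintro _ ⟨z, rfl⟩
      have h1 : (1 - ‖b * (z : ℂ)‖ ^ 2) * ‖deriv f (b * z)‖ ≤ A :=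
        hA ⟨⟨b * z, (hm z).2 z.2⟩, rfl⟩
      have h2 : deriv (fun z => a * f (b * z)) (z : ℂ) = a * (b * deriv f (b * z)) := by
        rw [deriv_const_mul_field, deriv_comp_mul_left, smul_eq_mul]
      simp only
      rw [h2]
      simpa [ha, hb] using h1⟩
  map_add' f g := Subtype.ext (funext fun z => mul_add a (f (b * z)) (g (b * z)))
  map_smul' c f := Subtype.ext (funext fun z => mul_left_comm a c (f (b * z)))
  norm_map' f := by
    have hm : ∀ z : ℂ, b * z ∈ disc ↔ z ∈ disc := fun z => by simp [hb]
    have hb0 : b ≠ 0 := by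
      rintro rfl
      simp at hb
    let e : disc ≃ disc :=
      { toFun := fun z => ⟨b * z, (hm z).2 z.2⟩
        invFun := fun z => ⟨b⁻¹ * z, (hm _).1 (by rw [mul_inv_cancel_left₀ hb0]; exact z.2)⟩
        left_inv := fun z => Subtype.ext (inv_mul_cancel_left₀ hb0 _)
        right_inv := fun z => Subtype.ext (mul_inv_cancel_left₀ hb0 _) }
    change ‖a * f (b * 0)‖ + Bloch.seminorm (fun z => a * f (b * z)) = ‖f 0‖ + Bloch.seminorm f
    have h : Bloch.seminorm (fun z => a * f (b * z)) = Bloch.seminorm f := by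
      rw [Bloch.seminorm, Bloch.seminorm,
        ← e.iSup_comp (g := fun z : disc => (1 - ‖(z : ℂ)‖ ^ 2) * ‖deriv f z‖)]
      congr 1
      funext z
      have h2 : deriv (fun z => a * f (b * z)) (z : ℂ) = a * (b * deriv f (b * z)) := by
        rw [deriv_const_mul_field, deriv_comp_mul_left, smul_eq_mul]
      rw [h2]
      simp [e, ha, hb]
    rw [h]
    simp [ha]

theorem rotIsom_mem (a b : ℂ) (ha : ‖a‖ = 1) (hb : ‖b‖ = 1) (f : Bloch) (hf : f ∈ littleBloch) :
    rotIsom a b ha hb f ∈ littleBloch := by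
  refine map_mem_closure (rotIsom a b ha hb).continuous hf ?_
  rintro _ ⟨p, rfl⟩
  refine ⟨Polynomial.C a * p.comp (Polynomial.C b * Polynomial.X), DFunLike.ext _ _ fun z => ?_⟩
  change _ = a * Bloch.ofPoly p (b * z)
  have hm : b * z ∈ disc ↔ z ∈ disc := by simp [hb]
  by_cases hz : z ∈ disc
  · rw [Bloch.ofPoly_apply _ hz, Bloch.ofPoly_apply _ (hm.2 hz)]
    simp
  · rw [Bloch.apply_eq_zero _ hz, Bloch.apply_eq_zero _ fun h => hz (hm.1 h), mul_zero]

/-- The group `(S_t f)(z) = e^{-2iγt} f(e^{-2it} z)` of isometries of the little Bloch space. -/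
def rotGroup (γ : ℝ) (t : ℝ) : littleBloch →ₗᵢ[ℂ] littleBloch where
  toFun f := ⟨rotIsom (exp (((-2 * γ * t : ℝ) : ℂ) * I)) (exp (((-2 * t : ℝ) : ℂ) * I))
    (norm_exp_ofReal_mul_I _) (norm_exp_ofReal_mul_I _) f, rotIsom_mem _ _ _ _ _ f.2⟩
  map_add' _ _ := Subtype.ext (map_add _ _ _)
  map_smul' _ _ := Subtype.ext (map_smul _ _ _)
  norm_map' f := LinearIsometry.norm_map (rotIsom _ _ (norm_exp_ofReal_mul_I (-2 * γ * t))
    (norm_exp_ofReal_mul_I (-2 * t))) (f : Bloch)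

theorem rotGroup_apply (γ t : ℝ) (f : littleBloch) (z : ℂ) :
    (rotGroup γ t f).1 z = exp (-2 * I * γ * t) * f.1 (exp (-2 * I * t) * z) := by
  change exp (((-2 * γ * t : ℝ) : ℂ) * I) * f.1 (exp (((-2 * t : ℝ) : ℂ) * I) * z) = _
  have h₁ : ((-2 * γ * t : ℝ) : ℂ) * I = -2 * I * γ * t := by push_cast; ring
  have h₂ : ((-2 * t : ℝ) : ℂ) * I = -2 * I * t := by push_cast; ring
  rw [h₁, h₂]

section Operators

variable {X : Type*} [NormedAddCommGroup X] [NormedSpace ℂ X]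

/-- The infinitesimal generator of a family `(T t)` of bounded operators (a strongly continuous
group or semigroup): its domain consists of those `f` for which `(T t f - f) / t` converges in norm
as `t → 0+`, and its value at `f` is the limit. -/
def generator (T : ℝ → X →L[ℂ] X) : X →ₗ.[ℂ] X where
  domain :=
    { carrier := {f | ∃ g, Tendsto (fun t : ℝ => ((t⁻¹ : ℝ) : ℂ) • (T t f - f)) (𝓝[>] 0) (𝓝 g)}
      zero_mem' := ⟨0, by simp⟩
      add_mem' := by
        rintro f₁ f₂ ⟨g₁, h₁⟩ ⟨g₂, h₂⟩
        refine ⟨g₁ + g₂, (h₁.add h₂).congr fun t => ?_⟩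
        rw [map_add, ← smul_add]
        congr 1
        abel
      smul_mem' := by
        rintro c f ⟨g, h⟩
        refine ⟨c • g, (h.const_smul c).congr fun t => ?_⟩
        rw [map_smul, ← smul_sub, smul_comm] }
  toFun :=
    { toFun := fun f => f.2.choose
      map_add' := fun f₁ f₂ => by
        refine tendsto_nhds_unique (f₁ + f₂).2.choose_spec
          ((f₁.2.choose_spec.add f₂.2.choose_spec).congr fun t => ?_)
        rw [Submodule.coe_add, map_add, ← smul_add]
        congr 1
        abel
      map_smul' := fun c f => by
        refine tendsto_nhds_unique (c • f).2.choose_spec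
          ((f.2.choose_spec.const_smul c).congr fun t => ?_)
        rw [Submodule.coe_smul, map_smul, ← smul_sub, smul_comm] }

theorem generator_spec (T : ℝ → X →L[ℂ] X) (f : (generator T).domain) :
    Tendsto (fun t : ℝ => ((t⁻¹ : ℝ) : ℂ) • (T t f - (f : X))) (𝓝[>] 0) (𝓝 (generator T f)) :=
  f.2.choose_spec

/-- `R` is the resolvent of the (unbounded) operator `A` at `μ`: a bounded two-sided inverse of
`μ - A : dom A → X`. -/
def IsResolventAt (A : X →ₗ.[ℂ] X) (μ : ℂ) (R : X →L[ℂ] X) : Prop :=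
  (∀ h : X, ∃ hd : R h ∈ A.domain, μ • R h - A ⟨R h, hd⟩ = h) ∧
    ∀ f : A.domain, R (μ • (f : X) - A f) = f

/-- The resolvent set of an unbounded operator. -/
def resolventSet (A : X →ₗ.[ℂ] X) : Set ℂ := {μ | ∃ R, IsResolventAt A μ R}

/-- The resolvent `R(μ, A) = (μ - A)⁻¹` at a point of the resolvent set. -/
def resolventOp (A : X →ₗ.[ℂ] X) (μ : ℂ) (hμ : μ ∈ resolventSet A) : X →L[ℂ] X := hμ.choose

theorem isResolventAt_resolventOp (A : X →ₗ.[ℂ] X) (μ : ℂ) (hμ : μ ∈ resolventSet A) :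
    IsResolventAt A μ (resolventOp A μ hμ) := hμ.choose_spec

/-- The spectrum of an unbounded operator. -/
def opSpectrum (A : X →ₗ.[ℂ] X) : Set ℂ := (resolventSet A)ᶜ

/-- The kernel of `μ - A`, as a subspace of `X`. -/
def kerSub (A : X →ₗ.[ℂ] X) (μ : ℂ) : Submodule ℂ X :=
  (LinearMap.ker (μ • A.domain.subtype - A.toFun)).map A.domain.subtype

/-- The point spectrum (the set of eigenvalues) of an unbounded operator. -/
def pointSpectrum (A : X →ₗ.[ℂ] X) : Set ℂ := {μ | kerSub A μ ≠ ⊥}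

end Operators

/-- The generator of the group `(S_t)` on the little Bloch space. -/
def rotGenerator (γ : ℝ) : littleBloch →ₗ.[ℂ] littleBloch :=
  generator fun t => (rotGroup γ t).toContinuousLinearMap

/-- The range of `M_z ^ m` on the little Bloch space, where `M_z g (z) = z g(z)`. -/
def ranMul (m : ℕ) : Submodule ℂ littleBloch where
  carrier := {h | ∃ g : littleBloch, ∀ z ∈ disc, h.1 z = z ^ m * g.1 z}
  zero_mem' := ⟨0, fun z _ => by simp⟩
  add_mem' := by
    rintro h₁ h₂ ⟨g₁, e₁⟩ ⟨g₂, e₂⟩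
    exact ⟨g₁ + g₂, fun z hz => by simp [e₁ z hz, e₂ z hz, mul_add]⟩
  smul_mem' := by
    rintro c h ⟨g, e⟩
    exact ⟨c • g, fun z hz => by simp [e z hz, mul_left_comm]⟩

/-- The integrand of `∫_0^z F(w) dw` along the segment `w = s z`, `0 ≤ s ≤ 1`. -/
def segIntegrand (F : ℂ → ℂ) (z : ℂ) (s : ℝ) : ℂ := F (s * z) * z

/-- The integral `∫_0^z F(w) dw` along the segment from `0` to `z`. -/
def segIntegral (F : ℂ → ℂ) (z : ℂ) : ℂ := ∫ s in (0 : ℝ)..1, segIntegrand F z s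

end LittleBloch

end

noncomputable section

namespace LittleBloch

/-! ### Growth estimates for Bloch functions -/

namespace Bloch

/-! Everything reduces to a first-order equation at a regular singular point. With `Γ f = -2i(γ f +
z f')`, the equation `μ f - Γ f = h` reads `z f' + c f = -(i/2) h`, where `c = -i(μ + 2iγ)/2` is
`eulerParam`. On Taylor coefficients it multiplies the `n`-th one by `c + n`, so it is singular only
for `c = -n`, that is `μ = -2(γ + n)i`, with kernel spanned by `z ^ n`.

For `Re c > 0` the solution with right side `h` is the radial mean `∫₀¹ s^(c-1) h(sz) ds`, a bounded
operator (`exists_radialMean`); uniqueness comes from `integral_cpow_mul_euler`. For other `c`,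
write `f = a + z g` and `h = b + z k`: the equation splits into `c a = b` and the same equation for
`g, k` with `c + 1`. Finitely many shifts reach the half-plane `Re c > 0` (`Euler.eq_zero`,
`exists_eulerSolution`).

The generator is identified by evaluating the norm limit pointwise. Conversely, if `g = -2i(γ f + z
f')` lies in the space, the orbit of `g` is norm continuous, and the mean value inequality, applied
to the value at `0` and to the derivative at each point, gives norm convergence of the difference
quotients (`tendsto_rotGroup_quotient`). Passing between `f'` and `z f'` uses boundedness of `M_z`
and of the backward shift.

On `h = z^m k` with `Re (c + m) > 0`, the solution is `z^m` times the radial mean of `k` with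
parameter `c + m`; substituting `ω = s z` turns this into the stated integral. -/

theorem norm_apply_zero_le (f : Bloch) : ‖f 0‖ ≤ ‖f‖ := by
  rw [norm_def]
  linarith [seminorm_nonneg f]

theorem norm_deriv_le (f : Bloch) {z : ℂ} (hz : z ∈ disc) :
    (1 - ‖z‖ ^ 2) * ‖deriv f z‖ ≤ ‖f‖ := by
  rw [norm_def]
  linarith [le_seminorm f ⟨z, hz⟩, norm_nonneg (f 0)]

theorem norm_le_of_bounds (f : Bloch) {a b : ℝ} (h0 : ‖f 0‖ ≤ a)
    (hb : ∀ z ∈ disc, (1 - ‖z‖ ^ 2) * ‖deriv f z‖ ≤ b) : ‖f‖ ≤ a + b := by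
  have : Nonempty disc := ⟨⟨0, by simp⟩⟩
  rw [norm_def]
  exact add_le_add h0 (ciSup_le fun z => hb z z.2)

end Bloch

theorem one_sub_sq_pos {z : ℂ} (hz : z ∈ disc) : (0 : ℝ) < 1 - ‖z‖ ^ 2 := by
  have := mem_ball_zero_iff.1 hz
  nlinarith [norm_nonneg z]

theorem zero_mem_disc : (0 : ℂ) ∈ disc := by simp

theorem disc_mem_nhds {z : ℂ} (hz : z ∈ disc) : disc ∈ 𝓝 z := Metric.isOpen_ball.mem_nhds hz

theorem deriv_congr_on_disc {f g : ℂ → ℂ} (h : ∀ z ∈ disc, f z = g z) {z : ℂ} (hz : z ∈ disc) :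
    deriv f z = deriv g z :=
  (Filter.eventuallyEq_of_mem (disc_mem_nhds hz) h).deriv_eq

namespace Bloch

theorem differentiableOn_deriv (f : Bloch) : DifferentiableOn ℂ (deriv f) disc :=
  f.differentiableOn.deriv Metric.isOpen_ball

theorem norm_sub_apply_zero_le (f : Bloch) {z : ℂ} (hz : z ∈ disc) :
    (1 - ‖z‖ ^ 2) * ‖f z - f 0‖ ≤ ‖f‖ * ‖z‖ := by
  have hp := one_sub_sq_pos hz
  have hsub : Metric.closedBall (0 : ℂ) ‖z‖ ⊆ disc := by
    intro w hw
    rw [mem_closedBall_zero_iff] at hw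
    exact mem_ball_zero_iff.2 (hw.trans_lt (mem_ball_zero_iff.1 hz))
  -- On the closed ball of radius `‖z‖` the weight is smallest on the boundary, so one derivative
  -- bound serves the whole ball. The true growth is logarithmic, but this crude bound is enough.
  have h := (convex_closedBall (0 : ℂ) ‖z‖).norm_image_sub_le_of_norm_deriv_le (𝕜 := ℂ) (f := f)
    (C := ‖f‖ / (1 - ‖z‖ ^ 2)) (x := 0) (y := z) (fun w hw => f.differentiableAt (hsub hw))
    (fun w hw => by
      rw [le_div_iff₀ hp, mul_comm]
      refine le_trans ?_ (f.norm_deriv_le (hsub hw))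
      have hw' := mem_closedBall_zero_iff.1 hw
      gcongr)
    (by simp) (by simp)
  rw [sub_zero] at h
  calc (1 - ‖z‖ ^ 2) * ‖f z - f 0‖ ≤ (1 - ‖z‖ ^ 2) * (‖f‖ / (1 - ‖z‖ ^ 2) * ‖z‖) := by gcongr
    _ = ‖f‖ * ‖z‖ := by field_simp

theorem norm_apply_le (f : Bloch) {z : ℂ} (hz : z ∈ disc) :
    (1 - ‖z‖ ^ 2) * ‖f z‖ ≤ 2 * ‖f‖ := by
  have hp := one_sub_sq_pos hz
  have h1 := f.norm_sub_apply_zero_le hz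
  have h2 := f.norm_apply_zero_le
  have h3 : ‖f z‖ ≤ ‖f z - f 0‖ + ‖f 0‖ := by
    simpa using norm_add_le (f z - f 0) (f 0)
  have h4 := mem_ball_zero_iff.1 hz
  nlinarith [norm_nonneg f, norm_nonneg z, norm_nonneg (f 0), mul_le_mul_of_nonneg_left h3 hp.le,
    mul_nonneg (norm_nonneg (f 0)) (sq_nonneg ‖z‖)]

/-- The Bloch function that agrees on the disc with a given holomorphic function of finite
Bloch seminorm. -/
def ofFun (F : ℂ → ℂ) (hF : DifferentiableOn ℂ F disc)
    (hb : ∃ A, ∀ z ∈ disc, (1 - ‖z‖ ^ 2) * ‖deriv F z‖ ≤ A) : Bloch :=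
  ⟨Set.indicator disc F, hF.congr fun z hz => Set.indicator_of_mem hz _,
    fun z hz => Set.indicator_of_notMem hz _, by
      obtain ⟨A, hA⟩ := hb
      refine ⟨A, ?_⟩
      rintro _ ⟨z, rfl⟩
      simp only
      rw [deriv_congr_on_disc (fun w hw => Set.indicator_of_mem hw F) z.2]
      exact hA z z.2⟩

theorem ofFun_apply {F : ℂ → ℂ} (hF : DifferentiableOn ℂ F disc)
    (hb : ∃ A, ∀ z ∈ disc, (1 - ‖z‖ ^ 2) * ‖deriv F z‖ ≤ A) {z : ℂ} (hz : z ∈ disc) :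
    ofFun F hF hb z = F z := Set.indicator_of_mem hz F

theorem ext_on_disc {f g : Bloch} (h : ∀ z ∈ disc, f z = g z) : f = g := by
  refine DFunLike.ext _ _ fun z => ?_
  by_cases hz : z ∈ disc
  · exact h z hz
  · rw [f.apply_eq_zero hz, g.apply_eq_zero hz]

end Bloch

theorem ext_on_disc {f g : littleBloch} (h : ∀ z ∈ disc, f.1 z = g.1 z) : f = g :=
  Subtype.ext (Bloch.ext_on_disc h)

theorem monomial_apply (n : ℕ) {z : ℂ} (hz : z ∈ disc) : (monomial n).1 z = z ^ n := by
  change Bloch.ofPoly (Polynomial.X ^ n) z = z ^ n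
  rw [Bloch.ofPoly_apply _ hz]
  simp

/-! ### Bounded operators on the little Bloch space: evaluation, multiplication, backward shift -/

/-- Evaluation at a point of the disc, as a bounded functional. -/
def evalCLM {z : ℂ} (hz : z ∈ disc) : littleBloch →L[ℂ] ℂ :=
  LinearMap.mkContinuous
    { toFun := fun f => f.1 z
      map_add' := fun _ _ => rfl
      map_smul' := fun _ _ => rfl } (2 / (1 - ‖z‖ ^ 2)) fun f => by
    have h := f.1.norm_apply_le hz
    rw [div_mul_eq_mul_div, le_div_iff₀ (one_sub_sq_pos hz), mul_comm]
    exact h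

/-- A bounded linear family of holomorphic functions that sends monomials to polynomials defines
a bounded operator of the little Bloch space. -/
theorem exists_operator (L : Bloch → ℂ → ℂ)
    (hadd : ∀ f g, ∀ z ∈ disc, L (f + g) z = L f z + L g z)
    (hsmul : ∀ (c : ℂ) (f), ∀ z ∈ disc, L (c • f) z = c * L f z)
    (hd : ∀ f, DifferentiableOn ℂ (L f) disc) (a b : ℝ)
    (h0 : ∀ f, ‖L f 0‖ ≤ a * ‖f‖)
    (hb : ∀ f, ∀ z ∈ disc, (1 - ‖z‖ ^ 2) * ‖deriv (L f) z‖ ≤ b * ‖f‖)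
    (hpoly : ∀ n : ℕ, ∃ p : Polynomial ℂ, ∀ z ∈ disc,
      L (Bloch.ofPoly (Polynomial.X ^ n)) z = p.eval z) :
    ∃ A : littleBloch →L[ℂ] littleBloch, ∀ f, ∀ z ∈ disc, (A f).1 z = L f.1 z := by
  let B₀ : Bloch →ₗ[ℂ] Bloch :=
    { toFun := fun f => Bloch.ofFun (L f) (hd f) ⟨_, hb f⟩
      map_add' := fun f g => Bloch.ext_on_disc fun z hz => by
        rw [Bloch.coe_add, Pi.add_apply, Bloch.ofFun_apply _ _ hz, Bloch.ofFun_apply _ _ hz,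
          Bloch.ofFun_apply _ _ hz, hadd f g z hz]
      map_smul' := fun c f => Bloch.ext_on_disc fun z hz => by
        rw [RingHom.id_apply, Bloch.coe_smul, Pi.smul_apply, Bloch.ofFun_apply _ _ hz,
          Bloch.ofFun_apply _ _ hz, hsmul c f z hz, smul_eq_mul] }
  have hB₀ : ∀ f, ∀ z ∈ disc, B₀ f z = L f z := fun f z hz => Bloch.ofFun_apply (hd f) ⟨_, hb f⟩ hz
  let B : Bloch →L[ℂ] Bloch := B₀.mkContinuous (a + b) fun f => by
    rw [add_mul]
    refine Bloch.norm_le_of_bounds _ ?_ fun z hz => ?_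
    · rw [hB₀ f 0 zero_mem_disc]
      exact h0 f
    · rw [deriv_congr_on_disc (hB₀ f) hz]
      exact hb f z hz
  have hp : ∀ p : Polynomial ℂ, B (Bloch.ofPoly p) ∈ LinearMap.range Bloch.ofPoly := by
    intro p
    induction p using Polynomial.induction_on' with
    | add p q hp hq => rw [map_add, map_add]; exact add_mem hp hq
    | monomial n c =>
      rw [← Polynomial.C_mul_X_pow_eq_monomial, ← Polynomial.smul_eq_C_mul, map_smul, map_smul]
      refine Submodule.smul_mem _ _ ?_
      obtain ⟨q, hq⟩ := hpoly n
      refine ⟨q, Bloch.ext_on_disc fun z hz => ?_⟩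
      rw [Bloch.ofPoly_apply _ hz]
      exact ((hB₀ _ z hz).trans (hq z hz)).symm
  -- A continuous map that preserves the polynomials preserves their closure.
  have hm : ∀ f ∈ littleBloch, B f ∈ littleBloch := fun f hf => by
    refine map_mem_closure B.continuous hf ?_
    rintro _ ⟨p, rfl⟩
    exact hp p
  exact ⟨(B.comp littleBloch.subtypeL).codRestrict littleBloch fun f => hm f f.2,
    fun f z hz => hB₀ f z hz⟩

/-- Multiplication by `z` is bounded on the little Bloch space. -/
theorem exists_mulZ : ∃ M : littleBloch →L[ℂ] littleBloch,
    ∀ f, ∀ z ∈ disc, (M f).1 z = z * f.1 z := by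
  refine exists_operator (fun f z => z * f z) (fun f g z _ => ?_) (fun c f z _ => ?_)
    -- The product vanishes at `0`; the constant 3 is 2 from the growth of `f` plus 1 from `z f'`.
    (fun f => differentiableOn_id.mul f.differentiableOn) 0 3 (fun f => by simp)
    (fun f z hz => ?_) fun n => ⟨Polynomial.X ^ (n + 1), fun z hz => ?_⟩
  · simp [mul_add]
  · simp [mul_left_comm]
  · have hder : deriv (fun w => w * f w) z = f z + z * deriv f z := by
      rw [deriv_fun_mul differentiableAt_fun_id (f.differentiableAt hz)]
      simp
    have h1 := f.norm_apply_le hz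
    have h2 := f.norm_deriv_le hz
    have h3 := one_sub_sq_pos hz
    have h4 := mem_ball_zero_iff.1 hz
    have h5 : ‖z * deriv f z‖ ≤ ‖deriv f z‖ := by
      rw [norm_mul]
      exact mul_le_of_le_one_left (norm_nonneg _) h4.le
    rw [hder]
    have h6 := (norm_add_le (f z) (z * deriv f z)).trans (add_le_add_right h5 _)
    nlinarith [mul_le_mul_of_nonneg_left h6 h3.le]
  · rw [Bloch.ofPoly_apply _ hz]
    simp [pow_succ']

/-- Away from the origin the quotient rule leaves two terms, each at most `‖f‖ / ‖z‖ ≤ 2‖f‖`. -/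
theorem norm_deriv_dslope_le (f : Bloch) {z : ℂ} (hz : z ∈ disc) (hz' : 1 / 2 ≤ ‖z‖) :
    (1 - ‖z‖ ^ 2) * ‖deriv (dslope f 0) z‖ ≤ 4 * ‖f‖ := by
  have hz0 : z ≠ 0 := by
    rintro rfl
    norm_num at hz'
  have hder : deriv (dslope f 0) z = deriv f z / z - (f z - f 0) / z ^ 2 := by
    have h : dslope f 0 =ᶠ[𝓝 z] fun w => (f w - f 0) / w := by
      filter_upwards [isOpen_ne.mem_nhds hz0] with w hw
      rw [dslope_of_ne _ hw, slope_def_field, sub_zero]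
    rw [h.deriv_eq, deriv_fun_div ((f.differentiableAt hz).sub_const _) differentiableAt_fun_id hz0]
    simp only [deriv_sub_const, deriv_id'', mul_one]
    field_simp
  have h3 := one_sub_sq_pos hz
  have h1 := f.norm_sub_apply_zero_le hz
  have h2 := f.norm_deriv_le hz
  have hzp : 0 < ‖z‖ := by linarith
  have h6 : ‖deriv (dslope f 0) z‖ ≤ ‖deriv f z‖ / ‖z‖ + ‖f z - f 0‖ / ‖z‖ ^ 2 := by
    rw [hder]
    refine (norm_sub_le _ _).trans ?_
    simp
  calc (1 - ‖z‖ ^ 2) * ‖deriv (dslope f 0) z‖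
      ≤ (1 - ‖z‖ ^ 2) * (‖deriv f z‖ / ‖z‖ + ‖f z - f 0‖ / ‖z‖ ^ 2) := by gcongr
    _ = (1 - ‖z‖ ^ 2) * ‖deriv f z‖ / ‖z‖ + (1 - ‖z‖ ^ 2) * ‖f z - f 0‖ / ‖z‖ ^ 2 := by ring
    _ ≤ ‖f‖ / ‖z‖ + ‖f‖ * ‖z‖ / ‖z‖ ^ 2 := by gcongr
    _ = 2 * ‖f‖ / ‖z‖ := by field_simp; ring
    _ ≤ 4 * ‖f‖ := by
      rw [div_le_iff₀ hzp]
      nlinarith [norm_nonneg f]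

/-- The backward shift `f ↦ (f - f(0)) / z` is bounded on the little Bloch space. -/
theorem exists_shift : ∃ T : littleBloch →L[ℂ] littleBloch,
    ∀ f, ∀ z ∈ disc, f.1 z = f.1 0 + z * (T f).1 z := by
  have key : ∀ (f : ℂ → ℂ) (z : ℂ), f z = f 0 + z * dslope f 0 z := fun f z => by
    have := sub_smul_dslope f 0 z
    rw [sub_zero, smul_eq_mul] at this
    rw [this]; ring
  have hdd : ∀ f : Bloch, DifferentiableOn ℂ (dslope f 0) disc := fun f =>
    (Complex.differentiableOn_dslope (disc_mem_nhds zero_mem_disc)).2 f.differentiableOn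
  suffices h : ∃ T : littleBloch →L[ℂ] littleBloch, ∀ f, ∀ z ∈ disc,
      (T f).1 z = dslope f.1 0 z by
    obtain ⟨T, hT⟩ := h
    exact ⟨T, fun f z hz => by rw [hT f z hz]; exact key _ _⟩
  refine exists_operator (fun f => dslope f 0) (fun f g z hz => ?_)
    (fun c f z hz => ?_) hdd 1 6 (fun f => ?_)
    (fun f z hz => ?_) fun n => ?_
  · by_cases h : z = 0
    · subst h
      simp only [dslope_same, Bloch.coe_add]
      exact deriv_add (f.differentiableAt hz) (g.differentiableAt hz)
    · simp only [dslope_of_ne _ h, slope_def_field, Bloch.coe_add, Pi.add_apply]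
      ring
  · by_cases h : z = 0
    · subst h
      simp only [dslope_same, Bloch.coe_smul]
      exact deriv_const_smul c (f.differentiableAt hz)
    · simp only [dslope_of_ne _ h, slope_def_field, Bloch.coe_smul, Pi.smul_apply, smul_eq_mul]
      ring
  · simpa using f.norm_deriv_le zero_mem_disc
  · rcases le_total (1 / 2) ‖z‖ with h | h
    · linarith [norm_deriv_dslope_le f hz h, norm_nonneg f]
    · have hsub : Metric.closedBall (0 : ℂ) (1 / 2) ⊆ disc :=
        Metric.closedBall_subset_ball (by norm_num)
      -- Near the origin the maximum principle transfers the bound from the circle `‖z‖ = 1/2`.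
      -- There the weight is `3/4`, so the derivative is at most `(16/3)‖f‖ ≤ 6‖f‖`.
      have hdc : DiffContOnCl ℂ (deriv (dslope f 0)) (Metric.ball 0 (1 / 2)) := by
        refine DifferentiableOn.diffContOnCl ?_
        rw [closure_ball _ (by norm_num)]
        exact ((hdd f).deriv Metric.isOpen_ball).mono hsub
      have hmax := Complex.norm_le_of_forall_mem_frontier_norm_le Metric.isBounded_ball hdc
        (C := 6 * ‖f‖) (fun w hw => by
          rw [frontier_ball _ (by norm_num)] at hw
          have hw' : ‖w‖ = 1 / 2 := mem_sphere_zero_iff_norm.1 hw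
          have := norm_deriv_dslope_le f (hsub (Metric.sphere_subset_closedBall hw)) hw'.ge
          rw [hw'] at this
          nlinarith [norm_nonneg f])
        (z := z) (by rw [closure_ball _ (by norm_num)]; simpa using h)
      have h3 := one_sub_sq_pos hz
      nlinarith [norm_nonneg f, norm_nonneg (deriv (dslope f 0) z), sq_nonneg ‖z‖]
  · cases n with
    | zero =>
      refine ⟨0, fun z hz => ?_⟩
      have h1 : ∀ w ∈ disc, Bloch.ofPoly (Polynomial.X ^ 0) w = 1 := fun w hw => by
        rw [Bloch.ofPoly_apply _ hw]; simp
      by_cases h : z = 0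
      · subst h
        rw [dslope_same, deriv_congr_on_disc (g := fun _ => 1) h1 hz]
        simp
      · rw [dslope_of_ne _ h, slope_def_field, h1 z hz, h1 0 zero_mem_disc]
        simp
    | succ n =>
      refine ⟨Polynomial.X ^ n, fun z hz => ?_⟩
      have h1 : ∀ w ∈ disc, Bloch.ofPoly (Polynomial.X ^ (n + 1)) w = w ^ (n + 1) := fun w hw => by
        rw [Bloch.ofPoly_apply _ hw]; simp
      by_cases h : z = 0
      · subst h
        rw [dslope_same, deriv_congr_on_disc (g := fun w => w ^ (n + 1)) h1 hz]
        cases n <;> simp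
      · rw [dslope_of_ne _ h, slope_def_field, h1 z hz, h1 0 zero_mem_disc]
        simp [pow_succ, h]

/-- Functions that agree after multiplication by `z` agree. -/
theorem eq_of_mul_eq {u v : ℂ → ℂ} (hu : ContinuousOn u disc) (hv : ContinuousOn v disc)
    (h : ∀ z ∈ disc, z * u z = z * v z) : ∀ z ∈ disc, u z = v z := by
  intro z hz
  by_cases h0 : z = 0
  · subst h0
    have h1 : Tendsto u (𝓝[≠] 0) (𝓝 (u 0)) :=
      (hu.continuousAt (disc_mem_nhds hz)).tendsto.mono_left nhdsWithin_le_nhds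
    have h2 : Tendsto v (𝓝[≠] 0) (𝓝 (v 0)) :=
      (hv.continuousAt (disc_mem_nhds hz)).tendsto.mono_left nhdsWithin_le_nhds
    refine tendsto_nhds_unique h1 (h2.congr' ?_)
    filter_upwards [self_mem_nhdsWithin, mem_nhdsWithin_of_mem_nhds (disc_mem_nhds hz)] with w hw hd
    exact (mul_left_cancel₀ hw (h w hd)).symm
  · exact mul_left_cancel₀ h0 (h z hz)


/-! ### Weighted radial means -/

theorem ofReal_mul_mem_disc {z : ℂ} (hz : z ∈ disc) {s : ℝ} (hs : s ∈ Set.Icc (0 : ℝ) 1) :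
    (s : ℂ) * z ∈ disc := by
  rw [mem_ball_zero_iff] at hz ⊢
  rw [norm_mul, Complex.norm_of_nonneg hs.1]
  exact (mul_le_of_le_one_left (norm_nonneg z) hs.2).trans_lt hz

theorem intervalIntegrable_cpow_mul {c : ℂ} (hc : 0 < c.re) {u : ℝ → ℂ}
    (hu : ContinuousOn u (Set.Icc 0 1)) :
    IntervalIntegrable (fun s : ℝ => (s : ℂ) ^ (c - 1) * u s) MeasureTheory.volume 0 1 := by
  refine (intervalIntegral.intervalIntegrable_cpow' (by simpa using hc)).mul_continuousOn ?_
  rwa [Set.uIcc_of_le zero_le_one]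

theorem continuousOn_comp_segment {u : ℂ → ℂ} (hu : ContinuousOn u disc) {z : ℂ} (hz : z ∈ disc) :
    ContinuousOn (fun s : ℝ => u (s * z)) (Set.Icc 0 1) :=
  hu.comp (by fun_prop) fun _ hs => ofReal_mul_mem_disc hz hs

/-- The weighted radial mean `∫_0^1 s^{c-1} f(sz) ds`. -/
def radialMean (c : ℂ) (f : ℂ → ℂ) (z : ℂ) : ℂ := ∫ s in (0 : ℝ)..1, (s : ℂ) ^ (c - 1) * f (s * z)

theorem Bloch.norm_deriv_segment_le (f : Bloch) {z : ℂ} {r : ℝ} (hr : r < 1) (hz : ‖z‖ ≤ r) {s : ℝ}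
    (hs : s ∈ Set.Icc (0 : ℝ) 1) : ‖(s : ℂ) * deriv f (s * z)‖ ≤ ‖f‖ / (1 - r ^ 2) := by
  have hr0 : 0 ≤ r := (norm_nonneg z).trans hz
  have h1 : ‖(s : ℂ) * z‖ ≤ r := by
    rw [norm_mul, Complex.norm_of_nonneg hs.1]
    exact (mul_le_of_le_one_left (norm_nonneg z) hs.2).trans hz
  have h2 := f.norm_deriv_le (z := s * z) (mem_ball_zero_iff.2 (h1.trans_lt hr))
  rw [norm_mul, Complex.norm_of_nonneg hs.1, le_div_iff₀ (by nlinarith)]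
  calc s * ‖deriv f (s * z)‖ * (1 - r ^ 2) ≤ 1 * ‖deriv f (s * z)‖ * (1 - ‖(s : ℂ) * z‖ ^ 2) := by
        gcongr
        · nlinarith
        · exact hs.2
    _ ≤ ‖f‖ := by linarith

/-- Differentiation under the integral sign: on a ball of radius `r < 1` around the origin the Bloch
bound dominates the derivative uniformly, and `s^(c-1)` is integrable because `Re c > 0`. -/
theorem hasDerivAt_radialMean {c : ℂ} (hc : 0 < c.re) (f : Bloch) {z : ℂ} (hz : z ∈ disc) :
    HasDerivAt (radialMean c f)
      (∫ s in (0 : ℝ)..1, (s : ℂ) ^ (c - 1) * (s * deriv f (s * z))) z := by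
  have hz' := mem_ball_zero_iff.1 hz
  set r := (1 + ‖z‖) / 2 with hr
  have hr1 : r < 1 := by linarith
  have hsub : ∀ x ∈ Metric.ball (0 : ℂ) r, x ∈ disc := fun x hx => by
    rw [mem_ball_zero_iff] at hx ⊢
    exact hx.trans hr1
  have hioc : ∀ s ∈ Set.uIoc (0 : ℝ) 1, s ∈ Set.Icc (0 : ℝ) 1 := fun s hs => by
    rw [Set.uIoc_of_le zero_le_one] at hs
    exact Set.Ioc_subset_Icc_self hs
  have hnhds : Metric.ball (0 : ℂ) r ∈ 𝓝 z :=
    Metric.isOpen_ball.mem_nhds (by rw [mem_ball_zero_iff]; linarith)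
  have hint : ∀ x ∈ disc, IntervalIntegrable (fun s : ℝ => (s : ℂ) ^ (c - 1) * f (s * x))
      MeasureTheory.volume 0 1 := fun x hx =>
    intervalIntegrable_cpow_mul hc (continuousOn_comp_segment f.differentiableOn.continuousOn hx)
  refine (intervalIntegral.hasDerivAt_integral_of_dominated_loc_of_deriv_le
    (F := fun x s => (s : ℂ) ^ (c - 1) * f (s * x))
    (F' := fun x s => (s : ℂ) ^ (c - 1) * (s * deriv f (s * x)))
    (bound := fun s => ‖(s : ℂ) ^ (c - 1)‖ * (‖f‖ / (1 - r ^ 2))) hnhds ?_ (hint z hz) ?_ ?_ ?_ ?_).2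
  · filter_upwards [hnhds] with x hx
    exact (intervalIntegrable_iff.1 (hint x (hsub x hx))).aestronglyMeasurable
  · exact (intervalIntegrable_iff.1 (intervalIntegrable_cpow_mul hc
      (Complex.continuous_ofReal.continuousOn.mul (continuousOn_comp_segment
        f.differentiableOn_deriv.continuousOn hz)))).aestronglyMeasurable
  · refine Eventually.of_forall fun s hs x hx => ?_
    rw [norm_mul]
    gcongr
    exact f.norm_deriv_segment_le hr1 (mem_ball_zero_iff.1 hx).le (hioc s hs)
  · exact (intervalIntegral.intervalIntegrable_cpow' (by simpa using hc)).norm.mul_const _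
  · refine Eventually.of_forall fun s hs x hx => ?_
    have h := (f.differentiableAt (ofReal_mul_mem_disc (hsub x hx) (hioc s hs))).hasDerivAt
    have h' := (h.comp x ((hasDerivAt_id x).const_mul (s : ℂ))).const_mul ((s : ℂ) ^ (c - 1))
    exact h'.congr_deriv (by ring)

/-- The integrand is the derivative of `s^c f(sz)`, which vanishes at `s = 0` since `Re c > 0`. The
identity yields both existence and uniqueness for the Euler equation. -/
theorem integral_cpow_mul_euler {c : ℂ} (hc : 0 < c.re) (f : Bloch) {z : ℂ} (hz : z ∈ disc) :
    ∫ s in (0 : ℝ)..1, (s : ℂ) ^ (c - 1) * ((s * z) * deriv f (s * z) + c * f (s * z)) = f z := by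
  have hc0 : c ≠ 0 := by
    rintro rfl
    simp at hc
  have hf := f.differentiableOn.continuousOn
  have hf' := f.differentiableOn_deriv.continuousOn
  have h := intervalIntegral.integral_eq_sub_of_hasDerivAt_of_le (a := 0) (b := 1)
    (f := fun s : ℝ => (s : ℂ) ^ c * f (s * z)) zero_le_one
    ((Complex.continuous_ofReal_cpow_const hc).continuousOn.mul (continuousOn_comp_segment hf hz))
    (f' := fun s : ℝ => (s : ℂ) ^ (c - 1) * ((s * z) * deriv f (s * z) + c * f (s * z)))
    (fun s hs => ?_)
    (intervalIntegrable_cpow_mul hc (((by fun_prop : Continuous fun s : ℝ =>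
      (s : ℂ) * z).continuousOn.mul (continuousOn_comp_segment hf' hz)).add
        ((continuousOn_comp_segment hf hz).const_mul c)))
  · rw [h]
    simp [hc0]
  · have hs0 : (s : ℂ) ≠ 0 := by exact_mod_cast hs.1.ne'
    have h1 := ((hasStrictDerivAt_cpow_const (c := c) (x := (s : ℂ))
      (ofReal_mem_slitPlane.2 hs.1)).hasDerivAt).comp_ofReal
    have h2 := (f.differentiableAt (ofReal_mul_mem_disc hz
      (Set.Ioo_subset_Icc_self hs))).hasDerivAt
    have h3 := (h2.comp (s : ℂ) ((hasDerivAt_id (s : ℂ)).mul_const z)).comp_ofReal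
    refine (h1.mul h3).congr_deriv ?_
    have h4 : (s : ℂ) ^ c = (s : ℂ) ^ (c - 1) * s := by
      rw [cpow_sub _ _ hs0, cpow_one, div_mul_cancel₀ _ hs0]
    simp only [Function.comp_apply, id_eq, one_mul]
    rw [h4]
    ring

/-- The radial mean is bounded on the little Bloch space. -/
theorem exists_radialMean {c : ℂ} (hc : 0 < c.re) : ∃ A : littleBloch →L[ℂ] littleBloch,
    ∀ f, ∀ z ∈ disc, (A f).1 z = radialMean c f.1 z := by
  have hint : ∀ f : Bloch, ∀ z ∈ disc, IntervalIntegrable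
      (fun s : ℝ => (s : ℂ) ^ (c - 1) * f (s * z)) MeasureTheory.volume 0 1 := fun f z hz =>
    intervalIntegrable_cpow_mul hc (continuousOn_comp_segment f.differentiableOn.continuousOn hz)
  have hnorm : IntervalIntegrable (fun s : ℝ => ‖(s : ℂ) ^ (c - 1)‖) MeasureTheory.volume 0 1 :=
    (intervalIntegral.intervalIntegrable_cpow' (by simpa using hc)).norm
  refine exists_operator (fun f => radialMean c f) (fun f g z hz => ?_) (fun k f z hz => ?_)
    (fun f z hz => (hasDerivAt_radialMean hc f hz).differentiableAt.differentiableWithinAt)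
    (∫ s in (0 : ℝ)..1, ‖(s : ℂ) ^ (c - 1)‖) (∫ s in (0 : ℝ)..1, ‖(s : ℂ) ^ (c - 1)‖)
    (fun f => ?_) (fun f z hz => ?_) fun n => ?_
  · simp only [radialMean, Bloch.coe_add, Pi.add_apply, mul_add]
    exact intervalIntegral.integral_add (hint f z hz) (hint g z hz)
  · simp only [radialMean, Bloch.coe_smul, Pi.smul_apply, smul_eq_mul, mul_left_comm _ k]
    exact intervalIntegral.integral_const_mul _ _
  · rw [← intervalIntegral.integral_mul_const]
    refine intervalIntegral.norm_integral_le_of_norm_le zero_le_one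
      (Eventually.of_forall fun s _ => ?_) (hnorm.mul_const _)
    rw [norm_mul, mul_zero]
    gcongr
    exact f.norm_apply_zero_le
  · have hp := one_sub_sq_pos hz
    rw [(hasDerivAt_radialMean hc f hz).deriv, mul_comm, ← le_div_iff₀ hp, mul_div_assoc,
      ← intervalIntegral.integral_mul_const]
    refine intervalIntegral.norm_integral_le_of_norm_le zero_le_one
      (Eventually.of_forall fun s hs => ?_) (hnorm.mul_const _)
    rw [norm_mul]
    gcongr
    exact f.norm_deriv_segment_le (mem_ball_zero_iff.1 hz) le_rfl (Set.Ioc_subset_Icc_self hs)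
  -- Monomials are eigenfunctions of the radial mean.
  · refine ⟨Polynomial.C (∫ s in (0 : ℝ)..1, (s : ℂ) ^ (c - 1) * s ^ n) * Polynomial.X ^ n,
      fun z hz => ?_⟩
    simp only [Polynomial.eval_mul, Polynomial.eval_C, Polynomial.eval_pow, Polynomial.eval_X]
    rw [← intervalIntegral.integral_mul_const]
    refine intervalIntegral.integral_congr fun s hs => ?_
    rw [Set.uIcc_of_le zero_le_one] at hs
    rw [Bloch.ofPoly_apply _ (ofReal_mul_mem_disc hz hs)]
    simp only [Polynomial.eval_pow, Polynomial.eval_X]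
    ring

/-! ### The Euler equation: uniqueness, kernels, bounded solutions -/

/-- The Euler equation `z f' + c f = h` on the disc. -/
def Euler (c : ℂ) (f h : littleBloch) : Prop :=
  ∀ z ∈ disc, z * deriv f.1 z + c * f.1 z = h.1 z

theorem euler_radialMean {c : ℂ} (hc : 0 < c.re) {f h : littleBloch}
    (hf : ∀ z ∈ disc, f.1 z = radialMean c h.1 z) : Euler c f h := by
  intro z hz
  have hh := h.1.differentiableOn.continuousOn
  have hh' := h.1.differentiableOn_deriv.continuousOn
  rw [deriv_congr_on_disc hf hz, hf z hz, (hasDerivAt_radialMean hc h.1 hz).deriv, radialMean,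
    ← intervalIntegral.integral_const_mul, ← intervalIntegral.integral_const_mul,
    ← intervalIntegral.integral_add, ← integral_cpow_mul_euler hc h.1 hz]
  · congr 1
    funext s
    ring
  · exact (intervalIntegrable_cpow_mul hc (Complex.continuous_ofReal.continuousOn.mul
      (continuousOn_comp_segment hh' hz))).const_mul z
  · exact (intervalIntegrable_cpow_mul hc (continuousOn_comp_segment hh hz)).const_mul c

theorem Euler.eq_zero_of_re_pos {c : ℂ} (hc : 0 < c.re) {f : littleBloch} (h : Euler c f 0) :
    f = 0 := by
  refine ext_on_disc fun z hz => ?_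
  rw [← integral_cpow_mul_euler hc f.1 hz]
  refine (intervalIntegral.integral_congr (g := fun _ => 0) fun s hs => ?_).trans (by simp)
  rw [Set.uIcc_of_le zero_le_one] at hs
  have := h _ (ofReal_mul_mem_disc hz hs)
  rw [this]
  simp

theorem deriv_add_mul (a : ℂ) (g : Bloch) {z : ℂ} (hz : z ∈ disc) :
    deriv (fun w => a + w * g w) z = g z + z * deriv g z := by
  rw [deriv_const_add, deriv_fun_mul differentiableAt_fun_id (g.differentiableAt hz)]
  simp

theorem euler_of_shift {c a b : ℂ} {f g h k : littleBloch}
    (hf : ∀ z ∈ disc, f.1 z = a + z * g.1 z) (hh : ∀ z ∈ disc, h.1 z = b + z * k.1 z)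
    (hab : c * a = b) (hgk : Euler (c + 1) g k) : Euler c f h := by
  intro z hz
  rw [deriv_congr_on_disc hf hz, hf z hz, hh z hz, deriv_add_mul _ _ hz, ← hab, ← hgk z hz]
  ring

theorem Euler.mul_apply_zero {c : ℂ} {f h : littleBloch} (he : Euler c f h) :
    c * f.1 0 = h.1 0 := by
  simpa using he 0 zero_mem_disc

/-- Once the constant terms cancel, both sides carry a factor `z`; dividing it out costs one unit in
`c`. -/
theorem Euler.shift {c a b : ℂ} {f g h k : littleBloch}
    (hf : ∀ z ∈ disc, f.1 z = a + z * g.1 z) (hh : ∀ z ∈ disc, h.1 z = b + z * k.1 z)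
    (he : Euler c f h) : Euler (c + 1) g k := by
  have h0 := he.mul_apply_zero
  rw [hf 0 zero_mem_disc, hh 0 zero_mem_disc, zero_mul, zero_mul, add_zero, add_zero] at h0
  refine eq_of_mul_eq ((continuousOn_id.mul g.1.differentiableOn_deriv.continuousOn).add
    (g.1.differentiableOn.continuousOn.const_mul _)) k.1.differentiableOn.continuousOn
    fun z hz => ?_
  have := he z hz
  rw [deriv_congr_on_disc hf hz, hf z hz, hh z hz, deriv_add_mul _ _ hz, ← h0] at this
  linear_combination this

/-- Here `m` counts the shifts needed to reach `Re c > 0`. At each one `c ≠ 0` kills the constant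
term. -/
theorem Euler.eq_zero (m : ℕ) : ∀ {c : ℂ} {f : littleBloch}, 0 < (c + m).re →
    (∀ n : ℕ, c ≠ -n) → Euler c f 0 → f = 0 := by
  obtain ⟨T, hT⟩ := exists_shift
  induction m with
  | zero =>
    intro c f hc _ h
    exact h.eq_zero_of_re_pos (by simpa using hc)
  | succ m ih =>
    intro c f hc hn h
    have h0 : f.1 0 = 0 := by
      have := h.mul_apply_zero
      exact (mul_eq_zero.1 this).resolve_left (by simpa using hn 0)
    have h1 : T f = 0 := by
      refine ih (c := c + 1) ?_ (fun n hcn => hn (n + 1) ?_)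
        (h.shift (hT f) (b := 0) (fun z _ => by simp))
      · rw [show c + 1 + m = c + (m + 1 : ℕ) by push_cast; ring]
        exact hc
      · push_cast
        linear_combination hcn
    refine ext_on_disc fun z hz => ?_
    rw [hT f z hz, h0, h1]
    simp

/-- Each shift strips a factor `z`. At `c = 0` the constant term is free, and one more shift reaches
`c = 1`, where the solution vanishes. -/
theorem Euler.exists_eq_smul_monomial (n : ℕ) : ∀ {f : littleBloch}, Euler (-n) f 0 →
    ∃ a : ℂ, f = a • monomial n := by
  obtain ⟨T, hT⟩ := exists_shift
  induction n with
  | zero =>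
    intro f h
    have h1 : T f = 0 := (h.shift (hT f) (b := 0) (fun z _ => by simp)).eq_zero_of_re_pos (by simp)
    refine ⟨f.1 0, ext_on_disc fun z hz => ?_⟩
    rw [hT f z hz, h1]
    simp [monomial_apply 0 hz]
  | succ n ih =>
    intro f h
    have h0 : f.1 0 = 0 := by
      have := h.mul_apply_zero
      exact (mul_eq_zero.1 this).resolve_left (neg_ne_zero.2 (Nat.cast_ne_zero.2 n.succ_ne_zero))
    have h1 := h.shift (hT f) (b := 0) (k := 0) (fun z _ => by simp)
    rw [show -((n + 1 : ℕ) : ℂ) + 1 = -n by push_cast; ring] at h1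
    obtain ⟨a, ha⟩ := ih h1
    refine ⟨a, ext_on_disc fun z hz => ?_⟩
    rw [hT f z hz, h0, ha]
    simp only [Submodule.coe_smul, Bloch.coe_smul, Pi.smul_apply, smul_eq_mul,
      monomial_apply _ hz]
    ring

theorem euler_monomial (n : ℕ) : Euler (-n) (monomial n) 0 := by
  intro z hz
  rw [deriv_congr_on_disc (fun w hw => monomial_apply n hw) hz, monomial_apply n hz]
  cases n with
  | zero => simp
  | succ n =>
    rw [deriv_pow_field, Nat.add_sub_cancel]
    simp
    ring

theorem monomial_ne_zero (n : ℕ) : monomial n ≠ 0 := by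
  intro h
  have h1 := monomial_apply n (z := 1 / 2) (by rw [mem_ball_zero_iff]; norm_num)
  rw [h] at h1
  exact pow_ne_zero n (by norm_num : (1 / 2 : ℂ) ≠ 0) h1.symm

/-- The Euler equation has a bounded solution operator when `c` is not a nonpositive integer. -/
theorem exists_eulerSolution (m : ℕ) : ∀ {c : ℂ}, 0 < (c + m).re → (∀ n : ℕ, c ≠ -n) →
    ∃ R : littleBloch →L[ℂ] littleBloch, ∀ h, Euler c (R h) h := by
  obtain ⟨T, hT⟩ := exists_shift
  obtain ⟨M, hM⟩ := exists_mulZ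
  induction m with
  | zero =>
    intro c hc _
    have hc' : 0 < c.re := by simpa using hc
    obtain ⟨A, hA⟩ := exists_radialMean hc'
    exact ⟨A, fun h => euler_radialMean hc' (hA h)⟩
  | succ m ih =>
    intro c hc hn
    obtain ⟨R, hR⟩ := ih (c := c + 1)
      (by rw [show c + 1 + m = c + (m + 1 : ℕ) by push_cast; ring]; exact hc)
      (fun n hcn => hn (n + 1) (by push_cast; linear_combination hcn))
    have hc0 : c ≠ 0 := by simpa using hn 0
    -- The solution is `h(0)/c + z R(T h)`, where `T` is the backward shift and `R` solves the
    -- equation for `c + 1`.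
    refine ⟨(c⁻¹ • evalCLM zero_mem_disc).smulRight (monomial 0) + M.comp (R.comp T), fun h => ?_⟩
    refine euler_of_shift (a := c⁻¹ * h.1 0) (fun z hz => ?_) (hT h) (mul_inv_cancel_left₀ hc0 _)
      (hR (T h))
    change c⁻¹ * h.1 0 * (monomial 0).1 z + (M (R (T h))).1 z = _
    rw [monomial_apply 0 hz, hM _ z hz, pow_zero, mul_one]

theorem exists_nat_re_pos (c : ℂ) : ∃ m : ℕ, 0 < (c + m).re := by
  obtain ⟨m, hm⟩ := exists_nat_gt (-c.re)
  exact ⟨m, by simp; linarith⟩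


/-! ### The rotation group and its difference quotients -/

theorem rotGroup_zero (γ : ℝ) : rotGroup γ 0 = LinearIsometry.id := by
  refine LinearIsometry.ext fun f => ext_on_disc fun z _ => ?_
  rw [rotGroup_apply]
  simp

theorem rotGroup_add (γ s t : ℝ) :
    rotGroup γ (s + t) = (rotGroup γ s).comp (rotGroup γ t) := by
  refine LinearIsometry.ext fun f => ext_on_disc fun z _ => ?_
  change _ = (rotGroup γ s (rotGroup γ t f)).1 z
  rw [rotGroup_apply, rotGroup_apply, rotGroup_apply, ← mul_assoc,
    ← mul_assoc, ← exp_add, ← exp_add]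
  push_cast
  ring_nf

theorem norm_exp_rot (t : ℝ) : ‖exp (-2 * I * t)‖ = 1 := by
  rw [show -2 * I * (t : ℂ) = ((-2 * t : ℝ) : ℂ) * I by push_cast; ring]
  exact norm_exp_ofReal_mul_I _

theorem rot_mem_disc {z : ℂ} (hz : z ∈ disc) (t : ℝ) : exp (-2 * I * t) * z ∈ disc := by
  rw [mem_ball_zero_iff] at hz ⊢
  rwa [norm_mul, norm_exp_rot, one_mul]

theorem rotGroup_monomial (γ t : ℝ) (n : ℕ) :
    rotGroup γ t (monomial n) = exp (-2 * I * (γ + n) * t) • monomial n := by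
  refine ext_on_disc fun z hz => ?_
  rw [rotGroup_apply, monomial_apply n (rot_mem_disc hz t)]
  simp only [Submodule.coe_smul, Bloch.coe_smul, Pi.smul_apply, smul_eq_mul, monomial_apply n hz]
  rw [mul_pow, ← exp_nat_mul, ← mul_assoc, ← exp_add]
  ring_nf

theorem continuous_rotGroup (γ : ℝ) (f : littleBloch) : Continuous fun t : ℝ => rotGroup γ t f := by
  have hpoly : ∀ p : Polynomial ℂ, ∃ g : littleBloch, g.1 = Bloch.ofPoly p ∧
      Continuous fun t : ℝ => rotGroup γ t g := by
    intro p
    induction p using Polynomial.induction_on' with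
    | add p q hp hq =>
      obtain ⟨g₁, e₁, h₁⟩ := hp
      obtain ⟨g₂, e₂, h₂⟩ := hq
      refine ⟨g₁ + g₂, by rw [map_add, ← e₁, ← e₂]; rfl, ?_⟩
      simp only [map_add]
      exact h₁.add h₂
    | monomial n c =>
      refine ⟨c • monomial n, ?_, ?_⟩
      · rw [← Polynomial.C_mul_X_pow_eq_monomial, ← Polynomial.smul_eq_C_mul, map_smul]
        rfl
      · simp only [map_smul, rotGroup_monomial]
        exact (by fun_prop : Continuous fun t : ℝ =>
          exp (-2 * I * (γ + n) * t)).smul continuous_const |>.const_smul c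
  -- Since each operator is isometric, a polynomial close to `f` has an orbit uniformly close to
  -- that of `f`, and polynomial orbits are continuous.
  refine continuous_of_uniform_approx_of_continuous fun u hu => ?_
  obtain ⟨ε, hε, hu⟩ := Metric.mem_uniformity_dist.1 hu
  obtain ⟨_, ⟨p, rfl⟩, hb⟩ := Metric.mem_closure_iff.1 f.2 ε hε
  obtain ⟨g, hg, hc⟩ := hpoly p
  refine ⟨_, hc, fun t => hu ?_⟩
  rw [LinearIsometry.dist_map, Subtype.dist_eq, hg]
  exact hb

/-- The weight `κ` is free because `f` rotates with weight `γ` and `f'` with weight `γ + 1`. -/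
theorem hasDerivAt_rot {u : ℂ → ℂ} (hu : DifferentiableOn ℂ u disc) (κ : ℂ) {z : ℂ}
    (hz : z ∈ disc) (t : ℝ) :
    HasDerivAt (fun t : ℝ => exp (-2 * I * κ * t) * u (exp (-2 * I * t) * z))
      (exp (-2 * I * κ * t) * (I * (-2 * κ * u (exp (-2 * I * t) * z) -
        2 * (exp (-2 * I * t) * z) * deriv u (exp (-2 * I * t) * z)))) t := by
  have hexp : ∀ a : ℂ, HasDerivAt (fun s : ℂ => exp (a * s)) (exp (a * t) * a) (t : ℂ) := fun a => by
    simpa using ((hasDerivAt_id (t : ℂ)).const_mul a).cexp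
  have h1 := (hu.differentiableAt (disc_mem_nhds (rot_mem_disc hz t))).hasDerivAt
  have h2 := h1.comp (t : ℂ) ((hexp (-2 * I)).mul_const z)
  exact (((hexp (-2 * I * κ)).mul h2).comp_ofReal).congr_deriv (by
    simp only [Function.comp_apply]
    ring)

theorem deriv_rotGroup (γ t : ℝ) (f : littleBloch) (z : ℂ) :
    deriv (rotGroup γ t f).1 z =
      exp (-2 * I * (γ + 1) * t) * deriv f.1 (exp (-2 * I * t) * z) := by
  have h : ⇑(rotGroup γ t f).1 = fun z => exp (-2 * I * γ * t) * f.1 (exp (-2 * I * t) * z) :=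
    funext fun z => rotGroup_apply γ t f z
  rw [h, deriv_const_mul_field, deriv_comp_mul_left, smul_eq_mul, ← mul_assoc, ← exp_add]
  ring_nf

theorem norm_sub_sub_le {φ φ' : ℝ → ℂ} {a : ℂ} {C t : ℝ} (ht : 0 ≤ t)
    (hφ : ∀ s, HasDerivAt φ (φ' s) s) (hb : ∀ s ∈ Set.Icc 0 t, ‖φ' s - a‖ ≤ C) :
    ‖φ t - φ 0 - t * a‖ ≤ C * t := by
  have h : ∀ s : ℝ, HasDerivAt (fun s : ℝ => φ s - s * a) (φ' s - a) s := fun s =>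
    ((hφ s).sub (((hasDerivAt_id (s : ℂ)).mul_const a).comp_ofReal)).congr_deriv (by simp)
  have := (convex_Icc (0 : ℝ) t).norm_image_sub_le_of_norm_hasDerivWithin_le
    (fun s _ => (h s).hasDerivWithinAt) hb (x := 0) (y := t) (by simpa using ht) (by simpa using ht)
  rw [sub_zero, Real.norm_of_nonneg ht] at this
  refine le_trans (le_of_eq ?_) this
  congr 1
  push_cast
  ring

/-- At each point the orbit of `f` has time derivative the orbit of `g`, and so do the
`z`-derivatives. Norm continuity of the orbit of `g` makes the mean value estimates uniform in `z`
after weighting. -/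
theorem tendsto_rotGroup_quotient (γ : ℝ) {f g : littleBloch}
    (hg : ∀ z ∈ disc, g.1 z = I * (-2 * γ * f.1 z - 2 * z * deriv f.1 z)) :
    Tendsto (fun t : ℝ => ((t⁻¹ : ℝ) : ℂ) • (rotGroup γ t f - f)) (𝓝[>] 0) (𝓝 g) := by
  have hdg : ∀ z ∈ disc, deriv g.1 z =
      I * (-2 * (γ + 1) * deriv f.1 z - 2 * z * deriv (deriv f.1) z) := fun z hz => by
    have h1 := (f.1.differentiableAt hz).hasDerivAt
    have h2 := (f.1.differentiableOn_deriv.differentiableAt (disc_mem_nhds hz)).hasDerivAt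
    rw [deriv_congr_on_disc hg hz]
    refine (((h1.const_mul (-2 * (γ : ℂ))).sub
      (((hasDerivAt_id z).const_mul 2).mul h2)).const_mul I).deriv.trans ?_
    simp only [id]
    ring
  have hd0 : ∀ z ∈ disc, ∀ t : ℝ, HasDerivAt (fun t : ℝ => (rotGroup γ t f).1 z)
      ((rotGroup γ t g).1 z) t := fun z hz t => by
    simp only [rotGroup_apply]
    rw [hg _ (rot_mem_disc hz t)]
    exact hasDerivAt_rot f.1.differentiableOn γ hz t
  have hd1 : ∀ z ∈ disc, ∀ t : ℝ, HasDerivAt (fun t : ℝ => deriv (rotGroup γ t f).1 z)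
      (deriv (rotGroup γ t g).1 z) t := fun z hz t => by
    simp only [deriv_rotGroup]
    rw [hdg _ (rot_mem_disc hz t)]
    exact hasDerivAt_rot f.1.differentiableOn_deriv (γ + 1) hz t
  have hderiv_sub : ∀ (u v : littleBloch), ∀ z ∈ disc,
      deriv (u - v).1 z = deriv u.1 z - deriv v.1 z := fun u v z hz =>
    deriv_sub (u.1.differentiableAt hz) (v.1.differentiableAt hz)
  have h0 : rotGroup γ 0 = LinearIsometry.id := rotGroup_zero γ
  rw [Metric.tendsto_nhds]
  intro ε hε
  have hcont := (continuous_rotGroup γ g).tendsto 0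
  rw [h0] at hcont
  obtain ⟨δ, hδ, hball⟩ := Metric.tendsto_nhds_nhds.1 hcont (ε / 3) (by positivity)
  filter_upwards [Ioo_mem_nhdsGT hδ] with t ht
  have hclose : ∀ s ∈ Set.Icc 0 t, ‖rotGroup γ s g - g‖ ≤ ε / 3 := fun s hs => by
    have := hball (x := s) (by
      rw [Real.dist_eq, sub_zero, abs_of_nonneg hs.1]
      exact hs.2.trans_lt ht.2)
    rw [dist_eq_norm] at this
    exact this.le
  -- One `ε / 3` for the value at `0`, one for the seminorm; their sum stays strictly below `ε`.
  have hmain : ‖rotGroup γ t f - f - (t : ℂ) • g‖ ≤ ε / 3 * t + ε / 3 * t := by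
    refine Bloch.norm_le_of_bounds (rotGroup γ t f - f - (t : ℂ) • g).1 ?_ fun z hz => ?_
    · have := norm_sub_sub_le (a := g.1 0) ht.1.le (hd0 0 zero_mem_disc) (fun s hs =>
        (Bloch.norm_apply_zero_le (rotGroup γ s g - g).1).trans (hclose s hs))
      rw [h0] at this
      exact this
    · have hp := one_sub_sq_pos hz
      have := norm_sub_sub_le (a := deriv g.1 z) (C := ε / 3 / (1 - ‖z‖ ^ 2)) ht.1.le (hd1 z hz)
        (fun s hs => by
          rw [le_div_iff₀ hp, mul_comm, ← hderiv_sub _ _ z hz]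
          exact (Bloch.norm_deriv_le _ hz).trans (hclose s hs))
      rw [h0] at this
      have e : deriv (rotGroup γ t f - f - (t : ℂ) • g).1 z =
          deriv (rotGroup γ t f).1 z - deriv f.1 z - t * deriv g.1 z := by
        rw [hderiv_sub _ _ z hz, hderiv_sub _ _ z hz]
        congr 1
        exact deriv_const_smul (t : ℂ) (g.1.differentiableAt hz)
      rw [e]
      calc _ ≤ (1 - ‖z‖ ^ 2) * (ε / 3 / (1 - ‖z‖ ^ 2) * t) :=
            mul_le_mul_of_nonneg_left this hp.le
        _ = ε / 3 * t := by field_simp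
  have ht0 : (t : ℂ) ≠ 0 := by exact_mod_cast ht.1.ne'
  have e : ((t⁻¹ : ℝ) : ℂ) • (rotGroup γ t f - f) - g =
      ((t⁻¹ : ℝ) : ℂ) • (rotGroup γ t f - f - (t : ℂ) • g) := by
    rw [smul_sub _ _ ((t : ℂ) • g), smul_smul, ofReal_inv, inv_mul_cancel₀ ht0, one_smul]
  rw [dist_eq_norm, e, norm_smul, norm_real, norm_inv, Real.norm_of_nonneg ht.1.le]
  have ht1 := ht.1
  calc t⁻¹ * ‖rotGroup γ t f - f - (t : ℂ) • g‖ ≤ t⁻¹ * (ε / 3 * t + ε / 3 * t) := by gcongr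
    _ = 2 * ε / 3 := by field_simp; ring
    _ < ε := by linarith

/-! ### The generator and its domain -/

theorem rotGenerator_apply (γ : ℝ) (f : (rotGenerator γ).domain) {z : ℂ} (hz : z ∈ disc) :
    (rotGenerator γ f).1 z = I * (-2 * γ * f.1.1 z - 2 * z * deriv f.1.1 z) := by
  have h1 := ((evalCLM hz).continuous.tendsto _).comp (generator_spec _ f)
  have h2 := (hasDerivAt_rot f.1.1.differentiableOn γ hz 0).tendsto_slope_zero_right
  refine (tendsto_nhds_unique h1 (h2.congr fun t => ?_)).trans ?_
  · change _ = ((t⁻¹ : ℝ) : ℂ) * ((rotGroup γ t f.1).1 z - f.1.1 z)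
    rw [rotGroup_apply]
    simp
  · simp

theorem mem_domain_of_forall {γ : ℝ} {f g : littleBloch}
    (h : ∀ z ∈ disc, g.1 z = z * deriv f.1 z) : f ∈ (rotGenerator γ).domain := by
  refine ⟨I • ((-2 * (γ : ℂ)) • f - (2 : ℂ) • g), tendsto_rotGroup_quotient γ fun z hz => ?_⟩
  change I * (-2 * γ * f.1 z - 2 * g.1 z) = _
  rw [h z hz]
  ring

theorem mem_domain_iff (γ : ℝ) (f : littleBloch) : f ∈ (rotGenerator γ).domain ↔
    ∃ g : littleBloch, ∀ z ∈ disc, g.1 z = deriv f.1 z := by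
  constructor
  · intro hf
    obtain ⟨T, hT⟩ := exists_shift
    -- Solving the generator formula for `z f'` puts it in the little Bloch space; the backward
    -- shift then recovers `f'`.
    let k : littleBloch := (I / 2) • rotGenerator γ ⟨f, hf⟩ - (γ : ℂ) • f
    have hk : ∀ z ∈ disc, k.1 z = z * deriv f.1 z := fun z hz => by
      change I / 2 * (rotGenerator γ ⟨f, hf⟩).1 z - γ * f.1 z = _
      rw [rotGenerator_apply γ _ hz]
      linear_combination (-γ * f.1 z - z * deriv f.1 z) * I_mul_I
    refine ⟨T k, eq_of_mul_eq (T k).1.differentiableOn.continuousOn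
      f.1.differentiableOn_deriv.continuousOn fun z hz => ?_⟩
    rw [← hk z hz, hT k z hz, hk 0 zero_mem_disc]
    simp
  · rintro ⟨g, hg⟩
    obtain ⟨M, hM⟩ := exists_mulZ
    exact mem_domain_of_forall (g := M g) fun z hz => by rw [hM g z hz, hg z hz]

/-! ### Spectrum and resolvent through the Euler equation -/

/-- The parameter of the Euler equation equivalent to `μ f - Γ f = h`. -/
def eulerParam (γ : ℝ) (μ : ℂ) : ℂ := -((μ + 2 * I * γ) / 2) * I

theorem euler_of_generator {γ : ℝ} {μ : ℂ} {h : littleBloch} (f : (rotGenerator γ).domain)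
    (e : μ • (f : littleBloch) - rotGenerator γ f = h) :
    Euler (eulerParam γ μ) f (-(I / 2) • h) := by
  intro z hz
  change _ = -(I / 2) * h.1 z
  rw [← e]
  change _ = -(I / 2) * (μ * f.1.1 z - (rotGenerator γ f).1 z)
  rw [rotGenerator_apply γ f hz, eulerParam]
  linear_combination (z * deriv f.1.1 z) * I_mul_I

theorem Euler.mem_domain {γ : ℝ} {c : ℂ} {f h : littleBloch} (he : Euler c f h) :
    f ∈ (rotGenerator γ).domain :=
  mem_domain_of_forall (g := h - c • f) fun z hz => by
    change h.1 z - c * f.1 z = _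
    rw [← he z hz]
    ring

theorem Euler.generator_eq {γ : ℝ} {μ : ℂ} {f h : littleBloch}
    (he : Euler (eulerParam γ μ) f (-(I / 2) • h)) :
    μ • f - rotGenerator γ ⟨f, he.mem_domain⟩ = h := by
  refine ext_on_disc fun z hz => ?_
  have h1 : _ = -(I / 2) * h.1 z := he z hz
  change μ * f.1 z - (rotGenerator γ ⟨f, he.mem_domain⟩).1 z = h.1 z
  rw [rotGenerator_apply γ _ hz]
  rw [eulerParam] at h1
  linear_combination (2 * I) * h1 + (μ * f.1 z + 2 * I * γ * f.1 z - h.1 z) * I_mul_I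

theorem eulerParam_eq_neg_iff (γ : ℝ) (μ : ℂ) (n : ℕ) :
    eulerParam γ μ = -n ↔ μ = -2 * ((γ : ℂ) + n) * I := by
  rw [eulerParam]
  constructor
  · intro h
    linear_combination (2 * I) * h + (μ + 2 * I * γ) * I_mul_I
  · rintro rfl
    linear_combination (n : ℂ) * I_mul_I

theorem mem_kerSub_iff {γ : ℝ} {μ : ℂ} {f : littleBloch} :
    f ∈ kerSub (rotGenerator γ) μ ↔ Euler (eulerParam γ μ) f 0 := by
  constructor
  · rintro ⟨g, hg, rfl⟩
    have := euler_of_generator (h := 0) g hg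
    rwa [smul_zero] at this
  · intro h
    have h' : Euler (eulerParam γ μ) f (-(I / 2) • (0 : littleBloch)) := by rwa [smul_zero]
    exact ⟨⟨f, h.mem_domain⟩, h'.generator_eq, rfl⟩

theorem kerSub_eq_span (γ : ℝ) (n : ℕ) :
    kerSub (rotGenerator γ) (-2 * ((γ : ℂ) + n) * I) = Submodule.span ℂ {monomial n} := by
  have hc := (eulerParam_eq_neg_iff γ _ n).2 rfl
  refine le_antisymm (fun f hf => ?_) ?_
  · rw [mem_kerSub_iff, hc] at hf
    obtain ⟨a, rfl⟩ := Euler.exists_eq_smul_monomial n hf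
    exact Submodule.smul_mem _ _ (Submodule.mem_span_singleton_self _)
  · rw [Submodule.span_singleton_le_iff_mem, mem_kerSub_iff, hc]
    exact euler_monomial n

/-- If `c = -n`, the eigenvector `z ^ n` would be sent to itself and to zero by a resolvent.
Otherwise the bounded Euler solution operator, scaled by `-(i/2)`, is a right inverse, and
uniqueness makes it a left inverse. -/
theorem mem_resolventSet_iff {γ : ℝ} {μ : ℂ} :
    μ ∈ resolventSet (rotGenerator γ) ↔ ∀ n : ℕ, eulerParam γ μ ≠ -n := by
  constructor
  · rintro ⟨R, -, hR⟩ n hn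
    have he : Euler (eulerParam γ μ) (monomial n) (-(I / 2) • (0 : littleBloch)) := by
      rw [hn, smul_zero]
      exact euler_monomial n
    have := hR ⟨monomial n, he.mem_domain⟩
    rw [he.generator_eq, map_zero] at this
    exact monomial_ne_zero n this.symm
  · intro hn
    obtain ⟨m, hm⟩ := exists_nat_re_pos (eulerParam γ μ)
    obtain ⟨R, hR⟩ := exists_eulerSolution m hm hn
    have he : ∀ h, Euler (eulerParam γ μ) ((-(I / 2) • R) h) (-(I / 2) • h) := fun h => by
      rw [smul_apply, ← map_smul]
      exact hR _
    refine ⟨-(I / 2) • R, fun h => ⟨(he h).mem_domain, (he h).generator_eq⟩, fun f => ?_⟩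
    have h1 := euler_of_generator (μ := μ) f rfl
    have h2 := he (μ • (f : littleBloch) - rotGenerator γ f)
    refine sub_eq_zero.1 (Euler.eq_zero m hm hn fun z hz => ?_)
    have e1 := h1 z hz
    have e2 := h2 z hz
    set u := (-(I / 2) • R) (μ • (f : littleBloch) - rotGenerator γ f)
    have e3 : deriv (u - (f : littleBloch)).1 z = deriv u.1 z - deriv f.1.1 z :=
      deriv_sub (u.1.differentiableAt hz) (f.1.1.differentiableAt hz)
    rw [e3]
    change z * (deriv u.1 z - deriv f.1.1 z) + eulerParam γ μ * (u.1 z - f.1.1 z) = 0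
    linear_combination e2 - e1

theorem opSpectrum_rotGenerator (γ : ℝ) : opSpectrum (rotGenerator γ) =
    {μ : ℂ | ∃ n : ℕ, μ = -2 * ((γ : ℂ) + n) * I} := by
  ext μ
  simp only [opSpectrum, Set.mem_compl_iff, mem_resolventSet_iff, Set.mem_ofPred_eq,
    ← eulerParam_eq_neg_iff]
  push Not
  rfl

theorem pointSpectrum_rotGenerator (γ : ℝ) : pointSpectrum (rotGenerator γ) =
    {μ : ℂ | ∃ n : ℕ, μ = -2 * ((γ : ℂ) + n) * I} := by
  ext μ
  constructor
  · intro hμ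
    by_contra hn
    rw [Set.mem_ofPred_eq] at hn
    push Not at hn
    obtain ⟨m, hm⟩ := exists_nat_re_pos (eulerParam γ μ)
    refine hμ ((Submodule.eq_bot_iff _).2 fun f hf => ?_)
    exact Euler.eq_zero m hm (fun n h => hn n ((eulerParam_eq_neg_iff γ μ n).1 h))
      (mem_kerSub_iff.1 hf)
  · rintro ⟨n, rfl⟩
    change kerSub _ _ ≠ ⊥
    rw [kerSub_eq_span, Ne, Submodule.span_singleton_eq_bot]
    exact monomial_ne_zero n

theorem resolventOp_eq_of_euler {γ : ℝ} {μ : ℂ} (hμ : μ ∈ resolventSet (rotGenerator γ))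
    {f h : littleBloch} (he : Euler (eulerParam γ μ) f (-(I / 2) • h)) :
    resolventOp (rotGenerator γ) μ hμ h = f := by
  have := (isResolventAt_resolventOp _ μ hμ).2 ⟨f, he.mem_domain⟩
  rwa [he.generator_eq] at this

/-! ### The integral formula on the range of `M_z ^ m` -/

/-- A positive factor leaves the argument unchanged, so the principal logarithm is additive here,
even on the branch cut. -/
theorem ofReal_mul_cpow {s : ℝ} (hs : 0 < s) {z : ℂ} (hz : z ≠ 0) (c : ℂ) :
    ((s : ℂ) * z) ^ c = (s : ℂ) ^ c * z ^ c := by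
  have hs0 : (s : ℂ) ≠ 0 := by exact_mod_cast hs.ne'
  rw [cpow_def_of_ne_zero (mul_ne_zero hs0 hz), cpow_def_of_ne_zero hs0, cpow_def_of_ne_zero hz,
    log_ofReal_mul hs hz, ofReal_log hs.le, add_mul, exp_add]

/-- The substitution `ω = s z`: the zero of `h` at the origin raises the exponent of `s` by `m`. The
endpoint `s = 0` is excluded because default values of powers of `0` can break the identity there.
-/
theorem segIntegrand_cpow_mul {c z : ℂ} (hz : z ∈ disc) (hz0 : z ≠ 0) {m : ℕ} {h k : littleBloch}
    (hk : ∀ z ∈ disc, h.1 z = z ^ m * k.1 z) {s : ℝ} (hs : s ∈ Set.Ioo (0 : ℝ) 1) :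
    segIntegrand (fun w => w ^ (c - 1) * h.1 w) z s =
      z ^ c * z ^ m * ((s : ℂ) ^ (c + m - 1) * k.1 (s * z)) := by
  have hs0 : (s : ℂ) ≠ 0 := by exact_mod_cast hs.1.ne'
  rw [segIntegrand, hk _ (ofReal_mul_mem_disc hz (Set.Ioo_subset_Icc_self hs)),
    ofReal_mul_cpow hs.1 hz0, show c + m - 1 = c - 1 + m by ring, cpow_add _ _ hs0, cpow_natCast,
    mul_pow, cpow_sub c 1 hz0, cpow_one]
  field_simp

theorem intervalIntegrable_segIntegrand {c z : ℂ} (hz : z ∈ disc) (hz0 : z ≠ 0) {m : ℕ}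
    (hm : 0 < (c + m).re) {h k : littleBloch} (hk : ∀ z ∈ disc, h.1 z = z ^ m * k.1 z) :
    IntervalIntegrable (segIntegrand (fun w => w ^ (c - 1) * h.1 w) z)
      MeasureTheory.volume 0 1 := by
  refine ((intervalIntegrable_cpow_mul hm (continuousOn_comp_segment
    k.1.differentiableOn.continuousOn hz)).const_mul (z ^ c * z ^ m)).congr_uIoo fun s hs => ?_
  rw [Set.uIoo_of_le zero_le_one] at hs
  exact (segIntegrand_cpow_mul hz hz0 hk hs).symm

theorem segIntegral_cpow_mul {c z : ℂ} (hz : z ∈ disc) (hz0 : z ≠ 0) {m : ℕ} {h k : littleBloch}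
    (hk : ∀ z ∈ disc, h.1 z = z ^ m * k.1 z) :
    segIntegral (fun w => w ^ (c - 1) * h.1 w) z =
      z ^ c * z ^ m * radialMean (c + m) k.1 z := by
  rw [radialMean, ← intervalIntegral.integral_const_mul]
  refine intervalIntegral.integral_congr_uIoo fun s hs => ?_
  rw [Set.uIoo_of_le zero_le_one] at hs
  exact segIntegrand_cpow_mul hz hz0 hk hs

/-- Multiplication by `z^m` carries solutions for `c + m` to solutions for `c`, so the radial mean
of `k` lifts to a solution for `h`. -/
theorem exists_euler_radialMean {c : ℂ} {m : ℕ} (hm : 0 < (c + m).re) {h k : littleBloch}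
    (hk : ∀ z ∈ disc, h.1 z = z ^ m * k.1 z) :
    ∃ f g : littleBloch, Euler c f h ∧ (∀ z ∈ disc, f.1 z = z ^ m * g.1 z) ∧
      ∀ z ∈ disc, g.1 z = radialMean (c + m) k.1 z := by
  obtain ⟨M, hM⟩ := exists_mulZ
  obtain ⟨A, hA⟩ := exists_radialMean hm
  have hMpow : ∀ (n : ℕ) (f : littleBloch), ∀ z ∈ disc, ((M ^ n) f).1 z = z ^ n * f.1 z := by
    intro n f z hz
    induction n with
    | zero => simp
    | succ n ih =>
      rw [pow_succ' M]
      change (M ((M ^ n) f)).1 z = _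
      rw [hM _ z hz, ih]
      ring
  have heuler : ∀ (n : ℕ) (c : ℂ) (u v : littleBloch), Euler (c + n) u v →
      Euler c ((M ^ n) u) ((M ^ n) v) := by
    intro n
    induction n with
    | zero =>
      intro c u v huv
      simpa using huv
    | succ n ih =>
      intro c u v huv
      rw [pow_succ' M]
      refine euler_of_shift (a := 0) (b := 0) (g := (M ^ n) u) (k := (M ^ n) v)
        (fun z hz => ?_) (fun z hz => ?_) (mul_zero c) (ih (c + 1) u v ?_)
      · rw [zero_add]
        exact hM _ z hz
      · rw [zero_add]
        exact hM _ z hz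
      · rwa [show c + 1 + n = c + (n + 1 : ℕ) by push_cast; ring]
  have hh : h = (M ^ m) k := ext_on_disc fun z hz => by rw [hMpow m k z hz, hk z hz]
  refine ⟨(M ^ m) (A k), A k, ?_, hMpow m (A k), hA k⟩
  rw [hh]
  exact heuler m c _ _ (euler_radialMean hm (hA k))

theorem resolventOp_mem_ranMul {γ : ℝ} {μ : ℂ} (hμ : μ ∈ resolventSet (rotGenerator γ)) {m : ℕ}
    (hm : 0 < (eulerParam γ μ + m).re) {h k : littleBloch}
    (hk : ∀ z ∈ disc, h.1 z = z ^ m * k.1 z) :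
    resolventOp (rotGenerator γ) μ hμ h ∈ ranMul m ∧ ∀ z ∈ disc,
      (resolventOp (rotGenerator γ) μ hμ h).1 z =
        -(I / 2) * (z ^ m * radialMean (eulerParam γ μ + m) k.1 z) := by
  obtain ⟨f, g, he, hfg, hg⟩ := exists_euler_radialMean hm hk
  have he' : Euler (eulerParam γ μ) (-(I / 2) • f) (-(I / 2) • h) := by
    intro z hz
    have e : deriv (-(I / 2) • f).1 z = -(I / 2) * deriv f.1 z :=
      deriv_const_smul _ (f.1.differentiableAt hz)
    rw [e]
    change z * (-(I / 2) * deriv f.1 z) + eulerParam γ μ * (-(I / 2) * f.1 z) = -(I / 2) * h.1 z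
    rw [← he z hz]
    ring
  rw [resolventOp_eq_of_euler hμ he']
  refine ⟨Submodule.smul_mem _ _ ⟨g, hfg⟩, fun z hz => ?_⟩
  change -(I / 2) * f.1 z = _
  rw [hfg z hz, hg z hz]

/-- Multiplication by `i` turns the imaginary part into minus the real part, so the bound on `m` is
the integrability condition for `s^(c+m-1)`. -/
theorem eulerParam_add_re_pos {γ : ℝ} {μ : ℂ} {m : ℕ} (h : (-(μ + 2 * γ * I) / 2).im < m) :
    0 < (eulerParam γ μ + m).re := by
  have e : (-(μ + 2 * γ * I) / 2).im = -(eulerParam γ μ).re := by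
    rw [show eulerParam γ μ = (-(μ + 2 * γ * I) / 2) * I by rw [eulerParam]; ring, mul_I_re,
      neg_neg]
  rw [e] at h
  rw [add_re, natCast_re]
  linarith

end LittleBloch
end

theorem proposition4p1 (γ : ℝ) :
    -- `(S_t)` is a strongly continuous group of isometries (each `S_t` is isometric by its type)
    (LittleBloch.rotGroup γ 0 = LinearIsometry.id ∧
      (∀ s t : ℝ, LittleBloch.rotGroup γ (s + t) =
        (LittleBloch.rotGroup γ s).comp (LittleBloch.rotGroup γ t)) ∧
      ∀ f : LittleBloch.littleBloch, Continuous fun t : ℝ => LittleBloch.rotGroup γ t f) ∧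
    -- (1) the generator and its domain
    ((∀ f : LittleBloch.littleBloch, f ∈ (LittleBloch.rotGenerator γ).domain ↔
        ∃ g : LittleBloch.littleBloch, ∀ z ∈ LittleBloch.disc, g.1 z = deriv f.1 z) ∧
      ∀ f : (LittleBloch.rotGenerator γ).domain, ∀ z ∈ LittleBloch.disc,
        (LittleBloch.rotGenerator γ f).1 z =
          Complex.I * (-2 * γ * f.1.1 z - 2 * z * deriv f.1.1 z)) ∧
    -- (2) the spectrum, the point spectrum and the eigenspaces
    (LittleBloch.opSpectrum (LittleBloch.rotGenerator γ) =
        {μ : ℂ | ∃ n : ℕ, μ = -2 * ((γ : ℂ) + n) * Complex.I} ∧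
      LittleBloch.pointSpectrum (LittleBloch.rotGenerator γ) =
        {μ : ℂ | ∃ n : ℕ, μ = -2 * ((γ : ℂ) + n) * Complex.I} ∧
      ∀ n : ℕ, LittleBloch.kerSub (LittleBloch.rotGenerator γ)
          (-2 * ((γ : ℂ) + n) * Complex.I) =
        Submodule.span ℂ {LittleBloch.monomial n}) ∧
    -- (3) the resolvent on the range of `M_z ^ m`
    (∀ (μ : ℂ) (hμ : μ ∈ LittleBloch.resolventSet (LittleBloch.rotGenerator γ)) (m : ℕ),
      (-(μ + 2 * γ * Complex.I) / 2).im < m →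
      ∀ h ∈ LittleBloch.ranMul m,
        LittleBloch.resolventOp (LittleBloch.rotGenerator γ) μ hμ h ∈ LittleBloch.ranMul m ∧
        ∀ z ∈ LittleBloch.disc, z ≠ 0 →
          IntervalIntegrable (LittleBloch.segIntegrand
            (fun w => w ^ (-((μ + 2 * Complex.I * γ) / 2) * Complex.I - 1) * h.1 w) z)
            MeasureTheory.volume 0 1 ∧
          (LittleBloch.resolventOp (LittleBloch.rotGenerator γ) μ hμ h).1 z =
            -(Complex.I / 2) * z ^ ((μ + 2 * Complex.I * γ) / 2 * Complex.I) *
              LittleBloch.segIntegral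
                (fun w => w ^ (-((μ + 2 * Complex.I * γ) / 2) * Complex.I - 1) * h.1 w) z) := by
  open LittleBloch in
  refine ⟨⟨rotGroup_zero γ, rotGroup_add γ, continuous_rotGroup γ⟩,
    ⟨mem_domain_iff γ, fun f z hz => rotGenerator_apply γ f hz⟩,
    ⟨opSpectrum_rotGenerator γ, pointSpectrum_rotGenerator γ, kerSub_eq_span γ⟩, ?_⟩
  rintro μ hμ m hm h ⟨k, hk⟩
  have hm' := LittleBloch.eulerParam_add_re_pos hm
  obtain ⟨hmem, hval⟩ := LittleBloch.resolventOp_mem_ranMul hμ hm' hk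
  refine ⟨hmem, fun z hz hz0 =>
    ⟨LittleBloch.intervalIntegrable_segIntegrand hz hz0 hm' hk, ?_⟩⟩
  have hseg := LittleBloch.segIntegral_cpow_mul (c := LittleBloch.eulerParam γ μ) hz hz0 hk
  have hexp : (μ + 2 * Complex.I * γ) / 2 * Complex.I = -LittleBloch.eulerParam γ μ := by
    rw [LittleBloch.eulerParam]
    ring
  -- The prefactor `z^(-c)` cancels the `z^c` produced by the substitution; no branch problem
  -- arises, as both powers have the same base.
  have hpow : z ^ (-LittleBloch.eulerParam γ μ) * z ^ LittleBloch.eulerParam γ μ = 1 := by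
    rw [← Complex.cpow_add _ _ hz0, neg_add_cancel, Complex.cpow_zero]
  rw [LittleBloch.eulerParam] at hseg
  rw [hval z hz, hseg, hexp]
  rw [LittleBloch.eulerParam] at hpow ⊢
  linear_combination (Complex.I / 2 * z ^ m *
    LittleBloch.radialMean (-((μ + 2 * Complex.I * γ) / 2) * Complex.I + m) k.1 z) * hpow
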